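/- Let $D\ge 1$, let $\alpha_1,\dots,\alpha_D>0$ with $\sum_c\alpha_c=1$, and let $g$ be a $D\times D$ matrix with positive real entries. Put $G_{cd}=\alpha_c g_{cd}^2$ and $\widehat G_{cd}=\alpha_c g_{dc}^2$, and let $\lambda$ be the Perron–Frobenius eigenvalue (equivalently, the spectral radius) of $G$. For $z\in\mathbb C$ and $\eta=\sqrt{-1}\,t$ with $t>0$, the system $$a_c=\frac{[G^{T}a]_c+\eta}{|z|^2-([\widehat G^{T}\widehat a]_c+\eta)([G^{T}a]_c+\eta)},\qquad \widehat a_c=\frac{[\widehat G^{T}\widehat a]_c+\eta}{|z|^2-([\widehat G^{T}\widehat a]_c+\eta)([G^{T}a]_c+\eta)}\qquad(1\le c\le D)$$ has a unique solution $a=a(z,\eta)$, $\widehat a=\widehat a(z,\eta)\in\mathbb C^D$ all of whose entries have positive imaginary part. Put $$b_c(z,\eta)=\frac{-z}{|z|^2-([\widehat G^{T}\widehat a]_c+\eta)([G^{T}a]_c+\eta)}.$$ There is a unique probability measure $\mu$ on $\mathbb C$ with $$\mu=-\frac1\pi\lim_{t\to0^+}\partial_z\sum_{c=1}^D\alpha_c\,b_c(z,\sqrt{-1}\,t)$$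 in the sense of distributions, i.e. $\int\varphi\,d\mu=\lim_{t\to0^+}\frac1\pi\int_{\mathbb C}\Big(\sum_c\alpha_c b_c(z,\sqrt{-1}\,t)\Big)\,\partial_z\varphi(z)\,d^2z$ for all $\varphi\in C_c^\infty(\mathbb C)$, where $\partial_z=\frac12(\partial_x-\sqrt{-1}\,\partial_y)$. (This $\mu$ is the limiting spectral measure of the random matrices with entries $g_{c_ic_j}J_{ij}$, where the $J_{ij}$ are i.i.d. centered with variance $1/N$ and $c_i$ is the block containing $i$, the $c$-th block having about $\alpha_cN$ indices.) Then $\mu$ is invariant under rotations about $0$, and its support is the closed disk $\{z\in\mathbb C:|z|\le\sqrt\lambda\}$. Moreover, if $|z|^2<\lambda$, there is $C_z>0$ such that $\big|\sum_c\alpha_c a_c(z,\sqrt{-1}\,t)\big|\ge C_z$ for all sufficiently small $t>0$; and if $|z|^2>\lambda$, then $a(z,\sqrt{-1}\,t)\to0$ and $\widehat a(z,\sqrt{-1}\,t)\to0$ as $t\to0^+$. -/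

import Mathlib

open scoped ContDiff

namespace BlockMatrix

/-- The matrix `G` with entries `G c d = α c * (g c d)²`. -/
def G {D : ℕ} (α : Fin D → ℝ) (g : Matrix (Fin D) (Fin D) ℝ) : Matrix (Fin D) (Fin D) ℝ :=
  Matrix.of fun c d => α c * g c d ^ 2

/-- The matrix `Ĝ` with entries `Ĝ c d = α c * (g d c)²`. -/
def Ghat {D : ℕ} (α : Fin D → ℝ) (g : Matrix (Fin D) (Fin D) ℝ) : Matrix (Fin D) (Fin D) ℝ :=
  Matrix.of fun c d => α c * g d c ^ 2

/-- The Perron–Frobenius eigenvalue of `G`, that is, the largest modulus of a complex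
eigenvalue of `G`. -/
noncomputable def perronEigenvalue {D : ℕ} (α : Fin D → ℝ)
    (g : Matrix (Fin D) (Fin D) ℝ) : ℝ :=
  (spectralRadius ℂ ((G α g).map (fun x : ℝ => (x : ℂ)))).toReal

/-- `[Gᵀ a]_c + η = ∑ d, α d * (g d c)² * a d + η`. -/
noncomputable def selfEnergy {D : ℕ} (α : Fin D → ℝ) (g : Matrix (Fin D) (Fin D) ℝ)
    (η : ℂ) (a : Fin D → ℂ) (c : Fin D) : ℂ :=
  ∑ d, (G α g d c : ℂ) * a d + η

/-- `[Ĝᵀ â]_c + η = ∑ d, α d * (g c d)² * â d + η`. -/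
noncomputable def selfEnergyHat {D : ℕ} (α : Fin D → ℝ) (g : Matrix (Fin D) (Fin D) ℝ)
    (η : ℂ) (a' : Fin D → ℂ) (c : Fin D) : ℂ :=
  ∑ d, (Ghat α g d c : ℂ) * a' d + η

/-- The common denominator `|z|² - ([Ĝᵀ â]_c + η) ([Gᵀ a]_c + η)`. -/
noncomputable def denom {D : ℕ} (α : Fin D → ℝ) (g : Matrix (Fin D) (Fin D) ℝ)
    (z η : ℂ) (a a' : Fin D → ℂ) (c : Fin D) : ℂ :=
  (‖z‖ : ℂ) ^ 2 - selfEnergyHat α g η a' c * selfEnergy α g η a c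

/-- `(a, â)` is a solution of the fixed-point equations at `(z, η)` with positive imaginary
parts. (Positivity excludes a vanishing denominator.) -/
structure IsSolution {D : ℕ} (α : Fin D → ℝ) (g : Matrix (Fin D) (Fin D) ℝ)
    (z η : ℂ) (a a' : Fin D → ℂ) : Prop where
  im_pos : ∀ c, 0 < (a c).im
  im_pos_hat : ∀ c, 0 < (a' c).im
  eq : ∀ c, a c = selfEnergy α g η a c / denom α g z η a a' c
  eq_hat : ∀ c, a' c = selfEnergyHat α g η a' c / denom α g z η a a' c

/-- `∑ c, α c * b c`, where `b c = -z / (|z|² - ([Ĝᵀ â]_c + η) ([Gᵀ a]_c + η))`. -/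
noncomputable def bTrace {D : ℕ} (α : Fin D → ℝ) (g : Matrix (Fin D) (Fin D) ℝ)
    (z η : ℂ) (a a' : Fin D → ℂ) : ℂ :=
  ∑ c, (α c : ℂ) * (-z / denom α g z η a a' c)

/-- The Wirtinger derivative `∂_z φ = (∂_x φ - i ∂_y φ) / 2`. -/
noncomputable def wirtinger (φ : ℂ → ℂ) (z : ℂ) : ℂ :=
  (1 / 2) * (fderiv ℝ φ z 1 - Complex.I * fderiv ℝ φ z Complex.I)

/-- `μ` is the probability measure `-(1/π) lim_{t → 0+} ∂_z ∑ c, α c * b c (z, i t)`; the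
derivative and the limit are in the sense of distributions on `ℂ`. -/
def IsLimitingMeasure {D : ℕ} (α : Fin D → ℝ) (g : Matrix (Fin D) (Fin D) ℝ)
    (μ : MeasureTheory.Measure ℂ) : Prop :=
  MeasureTheory.IsProbabilityMeasure μ ∧
  ∃ a a' : ℂ → ℝ → Fin D → ℂ,
    (∀ z : ℂ, ∀ t : ℝ, 0 < t → IsSolution α g z (t * Complex.I) (a z t) (a' z t)) ∧
    ∀ φ : ℂ → ℂ, ContDiff ℝ ∞ φ → HasCompactSupport φ →
      Filter.Tendsto
        (fun t : ℝ => (1 / (Real.pi : ℂ)) *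
          ∫ z : ℂ, bTrace α g z (t * Complex.I) (a z t) (a' z t) * wirtinger φ z)
        (nhdsWithin 0 (Set.Ioi 0)) (nhds (∫ z, φ z ∂μ))

end BlockMatrix

/-!
For `η = i t` the solution is purely imaginary, `a = i v` and `â = i w` with `v, w > 0`. It exists
because the system for `(v, w)` is monotone for the order of `v` and the reverse order of `w`, and
it is unique because in the upper half-plane the equations strictly contract the hyperbolic
distance.

With `q_c = |z|² / (|z|² + [Ĝᵀ w + t]_c [Gᵀ v + t]_c)` one has `b_c = -z q_c / |z|²`, so that the
trace of `b` is determined by the radial function `∑ c, α_c q_c`. The log sum inequality shows that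
this function is strictly increasing in `|z|`. Pairing the equation for `v` with a positive
eigenvector of `G` shows that, as `t → 0`, the sum `∑ c, α_c v_c` stays away from `0` when
`|z|² < λ` and tends to `0` when `|z|² ≥ λ`. In the first case compactness yields a solution at
`t = 0`, in the second every `q_c` tends to `1`. The limit of `∑ c, α_c q_c` is therefore a
distribution function on `[0, √λ]`, and an integration by parts in polar coordinates identifies
`μ` with the rotation invariant measure under which `|z|` has this distribution.
-/

namespace BlockMatrix

open Filter Topology MeasureTheory
open scoped Matrix

variable {D : ℕ} {α : Fin D → ℝ} {g : Matrix (Fin D) (Fin D) ℝ}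

/-! ### Transposition symmetry -/

lemma G_nonneg (hα : ∀ c, 0 ≤ α c) (c d : Fin D) : 0 ≤ G α g c d :=
  mul_nonneg (hα c) (sq_nonneg _)

lemma mul_G_transpose (c d : Fin D) : α c * G α gᵀ d c = α d * G α g c d := by
  simp only [G, Matrix.of_apply, Matrix.transpose_apply]
  ring

lemma selfEnergyHat_eq_selfEnergy_transpose (η : ℂ) (a : Fin D → ℂ) (c : Fin D) :
    selfEnergyHat α g η a c = selfEnergy α gᵀ η a c := rfl

lemma denom_transpose (z η : ℂ) (a a' : Fin D → ℂ) (c : Fin D) :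
    denom α gᵀ z η a' a c = denom α g z η a a' c :=
  congrArg ((‖z‖ : ℂ) ^ 2 - ·) (mul_comm _ _)

lemma IsSolution.transpose {z η : ℂ} {a a' : Fin D → ℂ} (h : IsSolution α g z η a a') :
    IsSolution α gᵀ z η a' a where
  im_pos := h.im_pos_hat
  im_pos_hat := h.im_pos
  eq c := by rw [denom_transpose, ← selfEnergyHat_eq_selfEnergy_transpose, ← h.eq_hat c]
  eq_hat c := by
    rw [denom_transpose, selfEnergyHat_eq_selfEnergy_transpose, Matrix.transpose_transpose,
      ← h.eq c]

/-! ### Uniqueness in the upper half-plane -/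

lemma im_div_sub_mul {E F : ℂ} {x : ℝ} (hN : (x : ℂ) ^ 2 - F * E ≠ 0) :
    (E / ((x : ℂ) ^ 2 - F * E)).im = ‖(x : ℂ) / ((x : ℂ) ^ 2 - F * E)‖ ^ 2 * E.im
      + ‖E / ((x : ℂ) ^ 2 - F * E)‖ ^ 2 * F.im := by
  set N := (x : ℂ) ^ 2 - F * E with hNdef
  have h0 : Complex.normSq N ≠ 0 := by simpa using hN
  have hre : N.re = x ^ 2 - (F.re * E.re - F.im * E.im) := by simp [hNdef, pow_two]
  have him : N.im = -(F.re * E.im + F.im * E.re) := by simp [hNdef, pow_two]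
  rw [Complex.div_im, norm_div, norm_div, div_pow, div_pow, Complex.sq_norm, Complex.sq_norm,
    Complex.sq_norm, Complex.normSq_apply E, Complex.normSq_ofReal]
  field_simp
  rw [hre, him]
  ring

lemma div_sub_mul_sub_div_sub_mul {E₁ F₁ E₂ F₂ x : ℂ} (h₁ : x ^ 2 - F₁ * E₁ ≠ 0)
    (h₂ : x ^ 2 - F₂ * E₂ ≠ 0) :
    E₁ / (x ^ 2 - F₁ * E₁) - E₂ / (x ^ 2 - F₂ * E₂)
      = (x / (x ^ 2 - F₁ * E₁)) * (x / (x ^ 2 - F₂ * E₂)) * (E₁ - E₂)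
        + (E₁ / (x ^ 2 - F₁ * E₁)) * (E₂ / (x ^ 2 - F₂ * E₂)) * (F₁ - F₂) := by
  rw [div_sub_div _ _ h₁ h₂, div_mul_div_comm, div_mul_div_comm, div_mul_eq_mul_div,
    div_mul_eq_mul_div, ← add_div]
  congr 1
  ring

lemma mul_sqrt_mul_sqrt_add_le {β₁ β₂ γ₁ γ₂ x₁ x₂ y₁ y₂ : ℝ}
    (hx₁ : 0 ≤ x₁) (hx₂ : 0 ≤ x₂) (hy₁ : 0 ≤ y₁) (hy₂ : 0 ≤ y₂) :
    β₁ * β₂ * (√x₁ * √x₂) + γ₁ * γ₂ * (√y₁ * √y₂)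
      ≤ √(β₁ ^ 2 * x₁ + γ₁ ^ 2 * y₁) * √(β₂ ^ 2 * x₂ + γ₂ ^ 2 * y₂) := by
  rw [← Real.sqrt_mul (show 0 ≤ β₁ ^ 2 * x₁ + γ₁ ^ 2 * y₁ by positivity)]
  refine Real.le_sqrt_of_sq_le ?_
  have cauchy_schwarz := sq_nonneg (β₁ * √x₁ * (γ₂ * √y₂) - γ₁ * √y₁ * (β₂ * √x₂))
  calc (β₁ * β₂ * (√x₁ * √x₂) + γ₁ * γ₂ * (√y₁ * √y₂)) ^ 2
      ≤ (β₁ ^ 2 * √x₁ ^ 2 + γ₁ ^ 2 * √y₁ ^ 2) * (β₂ ^ 2 * √x₂ ^ 2 + γ₂ ^ 2 * √y₂ ^ 2) := by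
        linarith
    _ = _ := by rw [Real.sq_sqrt hx₁, Real.sq_sqrt hx₂, Real.sq_sqrt hy₁, Real.sq_sqrt hy₂]

lemma norm_div_sub_mul_sub_lt {E₁ F₁ E₂ F₂ : ℂ} {x r : ℝ}
    (hN₁ : (x : ℂ) ^ 2 - F₁ * E₁ ≠ 0) (hN₂ : (x : ℂ) ^ 2 - F₂ * E₂ ≠ 0)
    (hE₁ : 0 < E₁.im) (hE₂ : 0 < E₂.im) (hF₁ : 0 < F₁.im) (hF₂ : 0 < F₂.im) (hr : 0 ≤ r)
    (hE : ‖E₁ - E₂‖ ≤ r * (√E₁.im * √E₂.im)) (hF : ‖F₁ - F₂‖ < r * (√F₁.im * √F₂.im)) :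
    ‖E₁ / ((x : ℂ) ^ 2 - F₁ * E₁) - E₂ / ((x : ℂ) ^ 2 - F₂ * E₂)‖
      < r * (√(E₁ / ((x : ℂ) ^ 2 - F₁ * E₁)).im * √(E₂ / ((x : ℂ) ^ 2 - F₂ * E₂)).im) := by
  rw [im_div_sub_mul hN₁, im_div_sub_mul hN₂, div_sub_mul_sub_div_sub_mul hN₁ hN₂]
  set N₁ := (x : ℂ) ^ 2 - F₁ * E₁
  set N₂ := (x : ℂ) ^ 2 - F₂ * E₂
  have norm_pos : ∀ {E N : ℂ}, 0 < E.im → N ≠ 0 → 0 < ‖E / N‖ := fun hE hN =>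
    norm_pos_iff.2 (div_ne_zero (fun h => by simp [h] at hE) hN)
  have h₁ := norm_pos hE₁ hN₁
  have h₂ := norm_pos hE₂ hN₂
  calc ‖x / N₁ * (x / N₂) * (E₁ - E₂) + E₁ / N₁ * (E₂ / N₂) * (F₁ - F₂)‖
      ≤ ‖x / N₁‖ * ‖x / N₂‖ * ‖E₁ - E₂‖ + ‖E₁ / N₁‖ * ‖E₂ / N₂‖ * ‖F₁ - F₂‖ := by
        simpa only [norm_mul] using
          norm_add_le (x / N₁ * (x / N₂) * (E₁ - E₂)) (E₁ / N₁ * (E₂ / N₂) * (F₁ - F₂))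
    _ < ‖x / N₁‖ * ‖x / N₂‖ * (r * (√E₁.im * √E₂.im))
        + ‖E₁ / N₁‖ * ‖E₂ / N₂‖ * (r * (√F₁.im * √F₂.im)) := by
        apply add_lt_add_of_le_of_lt <;> gcongr
    _ = r * (‖x / N₁‖ * ‖x / N₂‖ * (√E₁.im * √E₂.im)
        + ‖E₁ / N₁‖ * ‖E₂ / N₂‖ * (√F₁.im * √F₂.im)) := by ring
    _ ≤ _ := mul_le_mul_of_nonneg_left
        (mul_sqrt_mul_sqrt_add_le hE₁.le hE₂.le hF₁.le hF₂.le) hr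

lemma im_selfEnergy (η : ℂ) (a : Fin D → ℂ) (c : Fin D) :
    (selfEnergy α g η a c).im = ∑ d, G α g d c * (a d).im + η.im := by
  simp [selfEnergy]

lemma le_im_selfEnergy (hα : ∀ c, 0 ≤ α c) {a : Fin D → ℂ} (ha : ∀ c, 0 ≤ (a c).im) (η : ℂ)
    (c : Fin D) : η.im ≤ (selfEnergy α g η a c).im := by
  rw [im_selfEnergy]
  exact le_add_of_nonneg_left
    (Finset.sum_nonneg fun d _ => mul_nonneg (G_nonneg hα d c) (ha d))

lemma norm_selfEnergy_sub_lt (hα : ∀ c, 0 ≤ α c) {η : ℂ} (hη : 0 < η.im) {a b : Fin D → ℂ}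
    (ha : ∀ c, 0 ≤ (a c).im) (hb : ∀ c, 0 ≤ (b c).im) {r : ℝ} (hr : 0 < r)
    (hab : ∀ c, ‖a c - b c‖ ≤ r * (√(a c).im * √(b c).im)) (c : Fin D) :
    ‖selfEnergy α g η a c - selfEnergy α g η b c‖
      < r * (√(selfEnergy α g η a c).im * √(selfEnergy α g η b c).im) := by
  have hG := fun d => G_nonneg (g := g) hα d c
  have term_le (d : Fin D) : ‖(G α g d c : ℂ) * (a d - b d)‖
      ≤ r * (√(G α g d c * (a d).im) * √(G α g d c * (b d).im)) := by
    rw [norm_mul, Complex.norm_real, Real.norm_of_nonneg (hG d), Real.sqrt_mul (hG d),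
      Real.sqrt_mul (hG d), mul_mul_mul_comm, Real.mul_self_sqrt (hG d), mul_left_comm]
    exact mul_le_mul_of_nonneg_left (hab d) (hG d)
  have sum_nonneg {x : Fin D → ℂ} (hx : ∀ d, 0 ≤ (x d).im) : 0 ≤ ∑ d, G α g d c * (x d).im :=
    Finset.sum_nonneg fun d _ => mul_nonneg (hG d) (hx d)
  rw [im_selfEnergy, im_selfEnergy]
  calc ‖selfEnergy α g η a c - selfEnergy α g η b c‖
      = ‖∑ d, (G α g d c : ℂ) * (a d - b d)‖ := by
        simp only [selfEnergy, mul_sub, Finset.sum_sub_distrib, add_sub_add_right_eq_sub]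
    _ ≤ ∑ d, r * (√(G α g d c * (a d).im) * √(G α g d c * (b d).im)) :=
        norm_sum_le_of_le _ fun d _ => term_le d
    _ ≤ r * (√(∑ d, G α g d c * (a d).im) * √(∑ d, G α g d c * (b d).im)) := by
        rw [← Finset.mul_sum]
        gcongr
        exact Real.sum_sqrt_mul_sqrt_le _ (fun d => mul_nonneg (hG d) (ha d))
          (fun d => mul_nonneg (hG d) (hb d))
    _ < _ := by
        gcongr <;> linarith [sum_nonneg ha, sum_nonneg hb]

lemma IsSolution.denom_ne_zero {z η : ℂ} {a a' : Fin D → ℂ} (h : IsSolution α g z η a a')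
    (c : Fin D) : denom α g z η a a' c ≠ 0 := by
  intro h0
  simpa [h0, ← h.eq c] using (h.im_pos c).trans_eq (congrArg Complex.im (h.eq c))

lemma IsSolution.norm_sub_lt (hα : ∀ c, 0 ≤ α c) {z η : ℂ} (hη : 0 < η.im)
    {a a' b b' : Fin D → ℂ} (h₁ : IsSolution α g z η a a') (h₂ : IsSolution α g z η b b')
    {r : ℝ} (hr : 0 < r) (hab : ∀ c, ‖a c - b c‖ ≤ r * (√(a c).im * √(b c).im))
    (hab' : ∀ c, ‖a' c - b' c‖ ≤ r * (√(a' c).im * √(b' c).im)) (c : Fin D) :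
    ‖a c - b c‖ < r * (√(a c).im * √(b c).im) := by
  have im_pos {g : Matrix (Fin D) (Fin D) ℝ} {x : Fin D → ℂ} (hx : ∀ c, 0 < (x c).im) :
      0 < (selfEnergy α g η x c).im := hη.trans_le (le_im_selfEnergy hα (fun c => (hx c).le) η c)
  rw [h₁.eq c, h₂.eq c]
  exact norm_div_sub_mul_sub_lt (h₁.denom_ne_zero c) (h₂.denom_ne_zero c) (im_pos h₁.im_pos)
    (im_pos h₂.im_pos) (im_pos h₁.im_pos_hat) (im_pos h₂.im_pos_hat) hr.le
    (norm_selfEnergy_sub_lt hα hη (fun c => (h₁.im_pos c).le) (fun c => (h₂.im_pos c).le)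
      hr hab c).le
    (norm_selfEnergy_sub_lt hα hη (fun c => (h₁.im_pos_hat c).le)
      (fun c => (h₂.im_pos_hat c).le) hr hab' c)

-- `‖x - y‖ / √(x.im * y.im)` is an increasing function of the hyperbolic distance of `x` and `y`.
lemma eq_of_forall_norm_sub_lt {ι : Type*} [Finite ι] {x y : ι → ℂ} (hx : ∀ i, 0 < (x i).im)
    (hy : ∀ i, 0 < (y i).im)
    (contracts : ∀ r > 0, (∀ i, ‖x i - y i‖ ≤ r * (√(x i).im * √(y i).im)) →
      ∀ i, ‖x i - y i‖ < r * (√(x i).im * √(y i).im)) : x = y := by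
  cases isEmpty_or_nonempty ι
  · exact Subsingleton.elim _ _
  have hpos (i : ι) : 0 < √(x i).im * √(y i).im :=
    mul_pos (Real.sqrt_pos.2 (hx i)) (Real.sqrt_pos.2 (hy i))
  obtain ⟨k, hk⟩ := Finite.exists_max fun i => ‖x i - y i‖ / (√(x i).im * √(y i).im)
  set r := ‖x k - y k‖ / (√(x k).im * √(y k).im)
  have le_r (i : ι) : ‖x i - y i‖ ≤ r * (√(x i).im * √(y i).im) :=
    (div_le_iff₀ (hpos i)).1 (hk i)
  have r_eq_zero : r = 0 := by
    by_contra hr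
    have hr_pos : 0 < r :=
      (show 0 ≤ r from div_nonneg (norm_nonneg _) (hpos k).le).lt_of_ne' hr
    exact ((div_lt_iff₀ (hpos k)).2 (contracts r hr_pos le_r k)).false
  funext i
  simpa [r_eq_zero, sub_eq_zero] using le_r i

theorem IsSolution.unique (hα : ∀ c, 0 ≤ α c) {z η : ℂ} (hη : 0 < η.im)
    {a a' b b' : Fin D → ℂ} (h₁ : IsSolution α g z η a a') (h₂ : IsSolution α g z η b b') :
    a = b ∧ a' = b' := by
  rw [← Sum.elim_eq_iff]
  refine eq_of_forall_norm_sub_lt (Sum.forall.2 ⟨h₁.im_pos, h₁.im_pos_hat⟩)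
    (Sum.forall.2 ⟨h₂.im_pos, h₂.im_pos_hat⟩) fun r hr h => ?_
  obtain ⟨hab, hab'⟩ := Sum.forall.1 h
  exact Sum.forall.2 ⟨h₁.norm_sub_lt hα hη h₂ hr hab hab',
    h₁.transpose.norm_sub_lt hα hη h₂.transpose hr hab' hab⟩

/-! ### Existence of a purely imaginary solution -/

/-- The value `[Gᵀ v]_c + t` for real `v`. Its hatted counterpart `[Ĝᵀ w]_c + t` is
`energy α gᵀ t w c`. -/
def energy (α : Fin D → ℝ) (g : Matrix (Fin D) (Fin D) ℝ) (t : ℝ) (v : Fin D → ℝ)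
    (c : Fin D) : ℝ :=
  ∑ d, G α g d c * v d + t

/-- The right-hand side of the equation satisfied by `v` when `(i v, i w)` solves the fixed-point
equations at `|z|² = τ` and `η = i t`. -/
noncomputable def realUpdate (α : Fin D → ℝ) (g : Matrix (Fin D) (Fin D) ℝ) (τ t : ℝ)
    (v w : Fin D → ℝ) (c : Fin D) : ℝ :=
  energy α g t v c / (τ + energy α gᵀ t w c * energy α g t v c)

/-- `(i v, i w)` is a solution of the fixed-point equations at `|z|² = τ` and `η = i t`, with
positive imaginary parts. -/
structure IsRealSolution (α : Fin D → ℝ) (g : Matrix (Fin D) (Fin D) ℝ) (τ t : ℝ)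
    (v w : Fin D → ℝ) : Prop where
  pos : ∀ c, 0 < v c
  pos_hat : ∀ c, 0 < w c
  eq : ∀ c, v c = realUpdate α g τ t v w c
  eq_hat : ∀ c, w c = realUpdate α gᵀ τ t w v c

lemma IsRealSolution.transpose {τ t : ℝ} {v w : Fin D → ℝ} (h : IsRealSolution α g τ t v w) :
    IsRealSolution α gᵀ τ t w v :=
  ⟨h.pos_hat, h.pos, h.eq_hat, h.eq⟩

lemma le_energy (hα : ∀ c, 0 ≤ α c) {v : Fin D → ℝ} (hv : 0 ≤ v) (t : ℝ) (c : Fin D) :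
    t ≤ energy α g t v c :=
  le_add_of_nonneg_left (Finset.sum_nonneg fun d _ => mul_nonneg (G_nonneg hα d c) (hv d))

lemma energy_mono (hα : ∀ c, 0 ≤ α c) {v v' : Fin D → ℝ} (hv : v ≤ v') (t : ℝ) (c : Fin D) :
    energy α g t v c ≤ energy α g t v' c :=
  add_le_add_left (Finset.sum_le_sum fun d _ =>
    mul_le_mul_of_nonneg_left (hv d) (G_nonneg hα d c)) t

lemma realUpdate_pos (hα : ∀ c, 0 ≤ α c) {τ t : ℝ} (hτ : 0 ≤ τ) (ht : 0 < t) {v w : Fin D → ℝ}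
    (hv : 0 ≤ v) (hw : 0 ≤ w) (c : Fin D) : 0 < realUpdate α g τ t v w c := by
  have e_pos : 0 < energy α g t v c := ht.trans_le (le_energy hα hv t c)
  have e'_pos : 0 < energy α gᵀ t w c := ht.trans_le (le_energy hα hw t c)
  unfold realUpdate
  positivity

lemma realUpdate_le_inv (hα : ∀ c, 0 ≤ α c) {τ t : ℝ} (hτ : 0 ≤ τ) (ht : 0 < t)
    {v w : Fin D → ℝ} (hv : 0 ≤ v) (hw : 0 ≤ w) (c : Fin D) :
    realUpdate α g τ t v w c ≤ t⁻¹ := by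
  have e_pos : 0 < energy α g t v c := ht.trans_le (le_energy hα hv t c)
  have e'_ge : t ≤ energy α gᵀ t w c := le_energy hα hw t c
  have e'_pos : 0 < energy α gᵀ t w c := ht.trans_le e'_ge
  calc realUpdate α g τ t v w c
      ≤ energy α g t v c / (energy α gᵀ t w c * energy α g t v c) :=
        div_le_div_of_nonneg_left e_pos.le (by positivity) (le_add_of_nonneg_left hτ)
    _ = (energy α gᵀ t w c)⁻¹ := div_mul_cancel_right₀ e_pos.ne' _
    _ ≤ t⁻¹ := inv_anti₀ ht e'_ge

lemma realUpdate_le_realUpdate (hα : ∀ c, 0 ≤ α c) {τ t : ℝ} (hτ : 0 ≤ τ) (ht : 0 < t)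
    {v v' w w' : Fin D → ℝ} (hv : 0 ≤ v) (hw' : 0 ≤ w') (hvv' : v ≤ v') (hww' : w' ≤ w)
    (c : Fin D) : realUpdate α g τ t v w c ≤ realUpdate α g τ t v' w' c := by
  have hx : 0 < energy α g t v c := ht.trans_le (le_energy hα hv t c)
  have hy' : 0 < energy α gᵀ t w' c := ht.trans_le (le_energy hα hw' t c)
  have hxx' : energy α g t v c ≤ energy α g t v' c := energy_mono hα hvv' t c
  have hyy' : energy α gᵀ t w' c ≤ energy α gᵀ t w c := energy_mono hα hww' t c
  unfold realUpdate
  set x := energy α g t v c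
  set x' := energy α g t v' c
  set y := energy α gᵀ t w c
  set y' := energy α gᵀ t w' c
  have hx' : 0 < x' := hx.trans_le hxx'
  have hy : 0 < y := hy'.trans_le hyy'
  rw [div_le_div_iff₀ (by positivity) (by positivity)]
  have hτx : x * τ ≤ x' * τ := by gcongr
  have hxy : x * x' * y' ≤ x * x' * y := by gcongr
  linarith

-- The system is increasing for the order of `v` and the reverse order of `w`.
theorem exists_isRealSolution (hα : ∀ c, 0 ≤ α c) {τ t : ℝ} (hτ : 0 ≤ τ) (ht : 0 < t) :
    ∃ v w, IsRealSolution α g τ t v w := by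
  have : Fact ((0 : ℝ) ≤ t⁻¹) := ⟨by positivity⟩
  let Box := Fin D → Set.Icc (0 : ℝ) t⁻¹
  let val : Box → Fin D → ℝ := fun v c => v c
  have val_nonneg (v : Box) : 0 ≤ val v := fun c => (v c).2.1
  let update (g : Matrix (Fin D) (Fin D) ℝ) (v w : Box) : Box := fun c =>
    ⟨realUpdate α g τ t (val v) (val w) c,
      (realUpdate_pos hα hτ ht (val_nonneg v) (val_nonneg w) c).le,
      realUpdate_le_inv hα hτ ht (val_nonneg v) (val_nonneg w) c⟩
  have update_le (g : Matrix (Fin D) (Fin D) ℝ) {v v' w w' : Box} (hv : v ≤ v') (hw : w' ≤ w) :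
      update g v w ≤ update g v' w' := fun c =>
    realUpdate_le_realUpdate hα hτ ht (val_nonneg v) (val_nonneg w') hv hw c
  let F : Box × Boxᵒᵈ →o Box × Boxᵒᵈ :=
    { toFun := fun p => (update g p.1 (OrderDual.ofDual p.2),
        OrderDual.toDual (update gᵀ (OrderDual.ofDual p.2) p.1))
      monotone' := fun _ _ h => ⟨update_le g h.1 h.2, update_le gᵀ h.2 h.1⟩ }
  set v : Box := F.lfp.1
  set w : Box := OrderDual.ofDual F.lfp.2
  have fixed_v : v = update g v w := congrArg Prod.fst F.map_lfp.symm
  have fixed_w : w = update gᵀ w v := congrArg Prod.snd F.map_lfp.symm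
  have eq_v (c : Fin D) : val v c = realUpdate α g τ t (val v) (val w) c :=
    congrArg (fun x => val x c) fixed_v
  have eq_w (c : Fin D) : val w c = realUpdate α gᵀ τ t (val w) (val v) c :=
    congrArg (fun x => val x c) fixed_w
  exact ⟨val v, val w,
    fun c => eq_v c ▸ realUpdate_pos hα hτ ht (val_nonneg v) (val_nonneg w) c,
    fun c => eq_w c ▸ realUpdate_pos hα hτ ht (val_nonneg w) (val_nonneg v) c, eq_v, eq_w⟩

lemma selfEnergy_ofReal_mul_I (t : ℝ) (v : Fin D → ℝ) (c : Fin D) :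
    selfEnergy α g (t * Complex.I) (fun d => v d * Complex.I) c
      = energy α g t v c * Complex.I := by
  simp only [selfEnergy, energy, Complex.ofReal_add, Complex.ofReal_sum, Complex.ofReal_mul,
    add_mul, Finset.sum_mul, mul_assoc]

lemma denom_ofReal_mul_I (z : ℂ) (t : ℝ) (v w : Fin D → ℝ) (c : Fin D) :
    denom α g z (t * Complex.I) (fun d => v d * Complex.I) (fun d => w d * Complex.I) c
      = ((‖z‖ ^ 2 + energy α gᵀ t w c * energy α g t v c : ℝ) : ℂ) := by
  rw [denom, selfEnergyHat_eq_selfEnergy_transpose, selfEnergy_ofReal_mul_I,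
    selfEnergy_ofReal_mul_I]
  push_cast
  linear_combination (-(energy α gᵀ t w c * energy α g t v c : ℂ)) * Complex.I_mul_I

lemma selfEnergy_div_denom_ofReal_mul_I (z : ℂ) (t : ℝ) (v w : Fin D → ℝ) (c : Fin D) :
    selfEnergy α g (t * Complex.I) (fun d => v d * Complex.I) c
        / denom α g z (t * Complex.I) (fun d => v d * Complex.I) (fun d => w d * Complex.I) c
      = realUpdate α g (‖z‖ ^ 2) t v w c * Complex.I := by
  rw [denom_ofReal_mul_I, selfEnergy_ofReal_mul_I, mul_div_right_comm, ← Complex.ofReal_div]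
  rfl

theorem IsRealSolution.isSolution {z : ℂ} {t : ℝ} {v w : Fin D → ℝ}
    (h : IsRealSolution α g (‖z‖ ^ 2) t v w) :
    IsSolution α g z (t * Complex.I) (fun d => v d * Complex.I) (fun d => w d * Complex.I) where
  im_pos c := by simpa using h.pos c
  im_pos_hat c := by simpa using h.pos_hat c
  eq c := by rw [selfEnergy_div_denom_ofReal_mul_I, ← h.eq c]
  eq_hat c := by
    rw [← denom_transpose, selfEnergyHat_eq_selfEnergy_transpose,
      selfEnergy_div_denom_ofReal_mul_I, ← h.eq_hat c]

theorem existsUnique_isSolution (hα : ∀ c, 0 ≤ α c) (z : ℂ) {t : ℝ} (ht : 0 < t) :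
    ∃! p : (Fin D → ℂ) × (Fin D → ℂ), IsSolution α g z (t * Complex.I) p.1 p.2 := by
  obtain ⟨v, w, h⟩ := exists_isRealSolution (g := g) hα (sq_nonneg ‖z‖) ht
  refine ⟨(_, _), h.isSolution, fun p hp => ?_⟩
  exact Prod.ext_iff.2 (hp.unique hα (by simpa using ht) h.isSolution)

/-- The imaginary part `(v, w)` of the solution of the fixed-point equations at `|z|² = τ` and
`η = i t`; an arbitrary value unless `0 ≤ τ` and `0 < t`. -/
noncomputable def realSolution (α : Fin D → ℝ) (g : Matrix (Fin D) (Fin D) ℝ) (τ t : ℝ) :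
    (Fin D → ℝ) × (Fin D → ℝ) :=
  Classical.epsilon fun p => IsRealSolution α g τ t p.1 p.2

lemma isRealSolution_realSolution (hα : ∀ c, 0 ≤ α c) {τ t : ℝ} (hτ : 0 ≤ τ) (ht : 0 < t) :
    IsRealSolution α g τ t (realSolution α g τ t).1 (realSolution α g τ t).2 := by
  obtain ⟨v, w, h⟩ := exists_isRealSolution (g := g) hα hτ ht
  exact Classical.epsilon_spec (p := fun p : (Fin D → ℝ) × (Fin D → ℝ) =>
    IsRealSolution α g τ t p.1 p.2) ⟨(v, w), h⟩

/-! ### The Perron–Frobenius eigenvector -/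

section PerronFrobenius

variable {ι : Type*} [Fintype ι] {A : Matrix ι ι ℝ}

lemma mulVec_pos (hA : ∀ i j, 0 < A i j) {y : ι → ℝ} (hy : 0 < y) (i : ι) : 0 < (A *ᵥ y) i := by
  obtain ⟨hy_nonneg, j, hj⟩ := Pi.lt_def.1 hy
  exact Finset.sum_pos' (fun j _ => mul_nonneg (hA i j).le (hy_nonneg j))
    ⟨j, Finset.mem_univ _, mul_pos (hA i j) hj⟩

/-- The pairs `(x, k)` of a probability vector `x` and `k ≥ 0` with `k x ≤ A x`. The supremum of
`k` over this set is the Collatz–Wielandt formula for the Perron–Frobenius eigenvalue. -/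
def collatzWielandtSet (A : Matrix ι ι ℝ) : Set ((ι → ℝ) × ℝ) :=
  {p | p.1 ∈ stdSimplex ℝ ι ∧ 0 ≤ p.2 ∧ p.2 • p.1 ≤ A *ᵥ p.1}

lemma le_sum_of_mem_collatzWielandtSet (hA : ∀ i j, 0 ≤ A i j) {p : (ι → ℝ) × ℝ}
    (hp : p ∈ collatzWielandtSet A) : p.2 ≤ ∑ i, ∑ j, A i j := by
  obtain ⟨⟨x_nonneg, sum_x⟩, -, le_mulVec⟩ := hp
  have x_le_one (j : ι) : p.1 j ≤ 1 := by
    rw [← sum_x]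
    exact Finset.single_le_sum (fun i _ => x_nonneg i) (Finset.mem_univ j)
  calc p.2 = ∑ i, p.2 * p.1 i := by rw [← Finset.mul_sum, sum_x, mul_one]
    _ ≤ ∑ i, ∑ j, A i j * p.1 j := Finset.sum_le_sum fun i _ => le_mulVec i
    _ ≤ ∑ i, ∑ j, A i j := Finset.sum_le_sum fun i _ => Finset.sum_le_sum fun j _ =>
        mul_le_of_le_one_right (hA i j) (x_le_one j)

lemma isCompact_collatzWielandtSet (hA : ∀ i j, 0 ≤ A i j) :
    IsCompact (collatzWielandtSet A) := by
  have isClosed : IsClosed (collatzWielandtSet A) :=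
    ((isClosed_stdSimplex ℝ ι).preimage continuous_fst).inter
      ((isClosed_le continuous_const continuous_snd).inter
        (isClosed_le (by fun_prop) (continuous_const.matrix_mulVec continuous_fst)))
  exact ((isCompact_stdSimplex ℝ ι).prod isCompact_Icc).of_isClosed_subset isClosed
    fun p hp => ⟨hp.1, hp.2.1, le_sum_of_mem_collatzWielandtSet hA hp⟩

lemma collatzWielandtSet_nonempty [Nonempty ι] (hA : ∀ i j, 0 ≤ A i j) :
    (collatzWielandtSet A).Nonempty := by
  classical
  obtain ⟨i⟩ := ‹Nonempty ι›
  refine ⟨(Pi.single i 1, 0), single_mem_stdSimplex ℝ i, le_rfl, fun j => ?_⟩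
  rw [zero_smul]
  exact Finset.sum_nonneg fun l _ => mul_nonneg (hA j l) ((single_mem_stdSimplex ℝ i).1 l)

lemma exists_mem_collatzWielandtSet_gt [Nonempty ι] {k : ℝ} (hk : 0 ≤ k) {y : ι → ℝ}
    (hy : ∀ i, 0 < y i) (hlt : ∀ i, k * y i < (A *ᵥ y) i) :
    ∃ p ∈ collatzWielandtSet A, k < p.2 := by
  obtain ⟨m, hm⟩ := Finite.exists_min fun i => (A *ᵥ y) i / y i
  have k_lt : k < (A *ᵥ y) m / y m := (lt_div_iff₀ (hy m)).2 (hlt m)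
  have sum_pos : 0 < ∑ i, y i := Finset.sum_pos (fun i _ => hy i) Finset.univ_nonempty
  refine ⟨((∑ i, y i)⁻¹ • y, (A *ᵥ y) m / y m), ⟨⟨fun i => ?_, ?_⟩, hk.trans k_lt.le, ?_⟩, k_lt⟩
  · exact mul_nonneg (inv_nonneg.2 sum_pos.le) (hy i).le
  · simp only [Pi.smul_apply, smul_eq_mul, ← Finset.mul_sum, inv_mul_cancel₀ sum_pos.ne']
  · rw [Matrix.mulVec_smul, smul_comm]
    exact smul_le_smul_of_nonneg_left (fun i => (le_div_iff₀ (hy i)).1 (hm i))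
      (inv_nonneg.2 sum_pos.le)

-- If `k x ≤ A x` is not an equality, then `k` can be increased after replacing `x` by `A x`.
theorem exists_pos_eigenvector [Nonempty ι] (hA : ∀ i j, 0 < A i j) :
    ∃ k : ℝ, 0 < k ∧ ∃ x : ι → ℝ, (∀ i, 0 < x i) ∧ A *ᵥ x = k • x := by
  have hA_nonneg := fun i j => (hA i j).le
  obtain ⟨⟨x, k⟩, ⟨hx, hk, hle⟩, hmax⟩ :=
    (isCompact_collatzWielandtSet hA_nonneg).exists_isMaxOn
      (collatzWielandtSet_nonempty hA_nonneg) continuous_snd.continuousOn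
  dsimp only at hx hk hle
  have x_pos : 0 < x := lt_of_le_of_ne hx.1 fun h => by simpa [← h] using hx.2
  have Ax_pos := mulVec_pos hA x_pos
  have eigen : A *ᵥ x = k • x := by
    by_contra hne
    have lt (i : ι) : k * (A *ᵥ x) i < (A *ᵥ (A *ᵥ x)) i := by
      have := mulVec_pos hA (sub_pos.2 (lt_of_le_of_ne' hle hne)) i
      rwa [Matrix.mulVec_sub, Matrix.mulVec_smul, Pi.sub_apply, sub_pos] at this
    obtain ⟨p, hp, hkp⟩ := exists_mem_collatzWielandtSet_gt hk Ax_pos lt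
    exact (hmax hp).not_gt hkp
  have kx_pos (i : ι) : 0 < k * x i := (Ax_pos i).trans_eq (congrFun eigen i)
  obtain ⟨i⟩ := ‹Nonempty ι›
  have k_pos : 0 < k := pos_of_mul_pos_left (kx_pos i) (hx.1 i)
  exact ⟨k, k_pos, x, fun i => pos_of_mul_pos_right (kx_pos i) hk, eigen⟩

lemma mem_spectrum_iff_exists_mulVec_eq_smul [DecidableEq ι] {K : Type*} [Field K]
    {B : Matrix ι ι K} {μ : K} : μ ∈ spectrum K B ↔ ∃ u ≠ 0, B *ᵥ u = μ • u := by
  rw [← Matrix.spectrum_toLin', ← Module.End.hasEigenvalue_iff_mem_spectrum]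
  constructor
  · intro h
    obtain ⟨u, hu⟩ := h.exists_hasEigenvector
    exact ⟨u, hu.2, hu.apply_eq_smul⟩
  · rintro ⟨u, hu, h⟩
    exact Module.End.hasEigenvalue_of_hasEigenvector ⟨Module.End.mem_eigenspace_iff.2 h, hu⟩

lemma norm_le_of_mulVec_eq_smul (hA : ∀ i j, 0 ≤ A i j) {k : ℝ} {x : ι → ℝ}
    (hx : ∀ i, 0 < x i) (h : A *ᵥ x = k • x) {μ : ℂ} {u : ι → ℂ} (hu : u ≠ 0)
    (hμ : A.map (fun y : ℝ => (y : ℂ)) *ᵥ u = μ • u) : ‖μ‖ ≤ k := by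
  obtain ⟨i₀, hi₀⟩ := Function.ne_iff.1 hu
  have : Nonempty ι := ⟨i₀⟩
  obtain ⟨m, hm⟩ := Finite.exists_max fun i => ‖u i‖ / x i
  set r := ‖u m‖ / x m with hr
  have norm_le (j : ι) : ‖u j‖ ≤ r * x j := (div_le_iff₀ (hx j)).1 (hm j)
  have r_pos : 0 < r := pos_of_mul_pos_left
    ((norm_pos_iff.2 hi₀).trans_le (norm_le i₀)) (hx i₀).le
  have norm_um : ‖u m‖ = r * x m := by rw [hr, div_mul_cancel₀ _ (hx m).ne']
  refine le_of_mul_le_mul_right ?_ (mul_pos r_pos (hx m))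
  calc ‖μ‖ * (r * x m) = ‖∑ j, (A m j : ℂ) * u j‖ := by
        rw [← norm_um, ← norm_mul]
        exact congrArg norm (congrFun hμ m).symm
    _ ≤ ∑ j, A m j * (r * x j) := norm_sum_le_of_le _ fun j _ => by
        rw [norm_mul, Complex.norm_real, Real.norm_of_nonneg (hA m j)]
        exact mul_le_mul_of_nonneg_left (norm_le j) (hA m j)
    _ = r * (A *ᵥ x) m := by
        simp only [Matrix.mulVec, dotProduct, Finset.mul_sum, mul_left_comm]
    _ = k * (r * x m) := by rw [h, Pi.smul_apply, smul_eq_mul, mul_left_comm]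

theorem spectralRadius_map_ofReal [DecidableEq ι] [Nonempty ι] (hA : ∀ i j, 0 ≤ A i j) {k : ℝ}
    {x : ι → ℝ} (hx : ∀ i, 0 < x i) (h : A *ᵥ x = k • x) :
    spectralRadius ℂ (A.map (fun y : ℝ => (y : ℂ))) = ENNReal.ofReal k := by
  apply le_antisymm
  · refine iSup₂_le fun μ hμ => ?_
    obtain ⟨u, hu, he⟩ := mem_spectrum_iff_exists_mulVec_eq_smul.1 hμ
    rw [← enorm_eq_nnnorm, ← ofReal_norm]
    exact ENNReal.ofReal_le_ofReal (norm_le_of_mulVec_eq_smul hA hx h hu he)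
  · have mem : (k : ℂ) ∈ spectrum ℂ (A.map (fun y : ℝ => (y : ℂ))) := by
      refine mem_spectrum_iff_exists_mulVec_eq_smul.2 ⟨fun i => x i, fun h0 => ?_, ?_⟩
      · obtain ⟨i⟩ := ‹Nonempty ι›
        exact (hx i).ne' (by simpa using congrFun h0 i)
      · funext i
        simpa [Matrix.mulVec, dotProduct] using congrArg (fun y : ℝ => (y : ℂ)) (congrFun h i)
    calc ENNReal.ofReal k ≤ ‖(k : ℂ)‖₊ := by
          rw [← enorm_eq_nnnorm, ← ofReal_norm, Complex.norm_real]
          exact ENNReal.ofReal_le_ofReal (le_abs_self k)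
      _ ≤ _ := le_iSup₂ (f := fun (μ : ℂ) (_ : μ ∈ spectrum ℂ _) => (‖μ‖₊ : ENNReal)) (k : ℂ) mem

end PerronFrobenius

lemma G_pos (hα : ∀ c, 0 < α c) (hg : ∀ c d, 0 < g c d) (c d : Fin D) : 0 < G α g c d :=
  mul_pos (hα c) (pow_pos (hg c d) 2)

theorem exists_pos_perronEigenvector [Nonempty (Fin D)] (hα : ∀ c, 0 < α c)
    (hg : ∀ c d, 0 < g c d) : 0 < perronEigenvalue α g ∧
      ∃ x : Fin D → ℝ, (∀ c, 0 < x c) ∧ G α g *ᵥ x = perronEigenvalue α g • x := by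
  obtain ⟨k, hk, x, hx, h⟩ := exists_pos_eigenvector (G_pos hα hg)
  have perron_eq : perronEigenvalue α g = k := by
    rw [perronEigenvalue, spectralRadius_map_ofReal (fun c d => (G_pos hα hg c d).le) hx h,
      ENNReal.toReal_ofReal hk.le]
  exact perron_eq ▸ ⟨hk, x, hx, h⟩

/-! ### Identities for real solutions -/

/-- The number `τ / (τ + ([Ĝᵀ w]_c + t) ([Gᵀ v]_c + t))`. For `τ = |z|²` this is
`-conj z * b_c(z, i t)`, the contribution of the block `c` to the mass of a disk of radius `|z|`. -/
noncomputable def weight (α : Fin D → ℝ) (g : Matrix (Fin D) (Fin D) ℝ) (τ t : ℝ)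
    (v w : Fin D → ℝ) (c : Fin D) : ℝ :=
  τ / (τ + energy α gᵀ t w c * energy α g t v c)

/-- The mean of the weights with respect to `α`. -/
noncomputable def meanWeight (α : Fin D → ℝ) (g : Matrix (Fin D) (Fin D) ℝ) (τ t : ℝ)
    (v w : Fin D → ℝ) : ℝ :=
  ∑ c, α c * weight α g τ t v w c

lemma weight_transpose (τ t : ℝ) (v w : Fin D → ℝ) (c : Fin D) :
    weight α gᵀ τ t w v c = weight α g τ t v w c := by
  rw [weight, weight, Matrix.transpose_transpose, mul_comm]

namespace IsRealSolution

variable {τ t : ℝ} {v w : Fin D → ℝ}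

lemma energy_pos (h : IsRealSolution α g τ t v w) (hα : ∀ c, 0 ≤ α c) (ht : 0 ≤ t) (c : Fin D) :
    0 < energy α g t v c := by
  refine (ht.trans (le_energy hα (fun d => (h.pos d).le) t c)).lt_of_ne' fun h0 => ?_
  simpa [realUpdate, h0] using (h.pos c).trans_eq (h.eq c)

lemma denom_pos (h : IsRealSolution α g τ t v w) (hα : ∀ c, 0 ≤ α c) (hτ : 0 ≤ τ) (ht : 0 ≤ t)
    (c : Fin D) : 0 < τ + energy α gᵀ t w c * energy α g t v c :=
  add_pos_of_nonneg_of_pos hτ (mul_pos (h.transpose.energy_pos hα ht c) (h.energy_pos hα ht c))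

lemma mul_energy_transpose (h : IsRealSolution α g τ t v w) (hα : ∀ c, 0 ≤ α c) (hτ : 0 ≤ τ)
    (ht : 0 ≤ t) (c : Fin D) : v c * energy α gᵀ t w c = 1 - weight α g τ t v w c := by
  rw [h.eq c, realUpdate, weight, eq_sub_iff_add_eq, div_mul_eq_mul_div, ← add_div,
    div_eq_one_iff_eq (h.denom_pos hα hτ ht c).ne']
  ring

lemma mul_energy (h : IsRealSolution α g τ t v w) (hα : ∀ c, 0 ≤ α c) (hτ : 0 ≤ τ)
    (ht : 0 ≤ t) (c : Fin D) : w c * energy α g t v c = 1 - weight α g τ t v w c := by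
  rw [← weight_transpose, ← h.transpose.mul_energy_transpose hα hτ ht c,
    Matrix.transpose_transpose]

lemma weight_mul_energy_transpose (h : IsRealSolution α g τ t v w) (c : Fin D) :
    weight α g τ t v w c * energy α gᵀ t w c = τ * w c := by
  rw [h.eq_hat c, realUpdate, weight, Matrix.transpose_transpose]
  ring

lemma weight_pos (h : IsRealSolution α g τ t v w) (hα : ∀ c, 0 ≤ α c) (hτ : 0 < τ) (ht : 0 ≤ t)
    (c : Fin D) : 0 < weight α g τ t v w c :=
  div_pos hτ (h.denom_pos hα hτ.le ht c)

lemma weight_nonneg (h : IsRealSolution α g τ t v w) (hα : ∀ c, 0 ≤ α c) (hτ : 0 ≤ τ)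
    (ht : 0 ≤ t) (c : Fin D) : 0 ≤ weight α g τ t v w c :=
  div_nonneg hτ (h.denom_pos hα hτ ht c).le

lemma weight_lt_one (h : IsRealSolution α g τ t v w) (hα : ∀ c, 0 ≤ α c) (hτ : 0 ≤ τ)
    (ht : 0 ≤ t) (c : Fin D) : weight α g τ t v w c < 1 := by
  have mul_pos := mul_pos (h.pos c) (h.transpose.energy_pos hα ht c)
  rwa [h.mul_energy_transpose hα hτ ht c, sub_pos] at mul_pos

lemma meanWeight_nonneg (h : IsRealSolution α g τ t v w) (hα : ∀ c, 0 ≤ α c) (hτ : 0 ≤ τ)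
    (ht : 0 ≤ t) : 0 ≤ meanWeight α g τ t v w :=
  Finset.sum_nonneg fun c _ => mul_nonneg (hα c) (h.weight_nonneg hα hτ ht c)

lemma meanWeight_le_one (h : IsRealSolution α g τ t v w) (hα : ∀ c, 0 ≤ α c)
    (hsum : ∑ c, α c = 1) (hτ : 0 ≤ τ) (ht : 0 ≤ t) : meanWeight α g τ t v w ≤ 1 := by
  rw [← hsum]
  exact Finset.sum_le_sum fun c _ =>
    mul_le_of_le_one_right (hα c) (h.weight_lt_one hα hτ ht c).le

end IsRealSolution

/-! ### Monotonicity in `τ` -/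

lemma sub_le_mul_log_sub_log {x y : ℝ} (hx : 0 < x) (hy : 0 < y) :
    x - y ≤ x * (Real.log x - Real.log y) := by
  have h := mul_le_mul_of_nonneg_left (Real.log_le_sub_one_of_pos (div_pos hy hx)) hx.le
  rw [Real.log_div hy.ne' hx.ne', mul_sub x (y / x), mul_div_cancel₀ _ hx.ne'] at h
  linarith

lemma log_sum_inequality {ι : Type*} [Fintype ι] {k x y : ι → ℝ} {t σ ρ : ℝ}
    (hk : ∀ i, 0 ≤ k i) (hx : ∀ i, 0 < x i) (hy : ∀ i, 0 < y i) (ht : 0 ≤ t) (hσ : 0 < σ)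
    (hρ : 0 < ρ) (hσ_eq : ∑ i, k i * x i + t = σ) (hρ_eq : ∑ i, k i * y i + t = ρ) :
    σ * (Real.log σ - Real.log ρ) ≤ ∑ i, k i * (x i * (Real.log (x i) - Real.log (y i))) := by
  set L := Real.log σ - Real.log ρ
  have rescaled (i : ι) :
      x i - y i * (σ / ρ) ≤ x i * (Real.log (x i) - Real.log (y i)) - x i * L := by
    have h := sub_le_mul_log_sub_log (hx i) (mul_pos (hy i) (div_pos hσ hρ))
    rw [Real.log_mul (hy i).ne' (div_pos hσ hρ).ne', Real.log_div hσ.ne' hρ.ne'] at h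
    linarith
  have defect : t * L ≤ t * (σ / ρ - 1) := by
    refine mul_le_mul_of_nonneg_left ?_ ht
    exact (Real.log_div hσ.ne' hρ.ne').symm.trans_le
      (Real.log_le_sub_one_of_pos (div_pos hσ hρ))
  have summed := Finset.sum_le_sum fun i (_ : i ∈ Finset.univ) =>
    mul_le_mul_of_nonneg_left (rescaled i) (hk i)
  simp only [mul_sub, Finset.sum_sub_distrib, ← mul_assoc, ← Finset.sum_mul] at summed ⊢
  rw [eq_sub_of_add_eq hσ_eq, eq_sub_of_add_eq hρ_eq, sub_mul ρ, mul_div_cancel₀ _ hρ.ne']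
    at summed
  linarith

lemma sub_mul_log_sub_log_nonneg {x y : ℝ} (hx : 0 < x) (hy : 0 < y) :
    0 ≤ (x - y) * (Real.log x - Real.log y) := by
  rcases le_total x y with h | h
  · exact mul_nonneg_of_nonpos_of_nonpos (sub_nonpos.2 h)
      (sub_nonpos.2 (Real.log_le_log hx h))
  · exact mul_nonneg (sub_nonneg.2 h) (sub_nonneg.2 (Real.log_le_log hy h))

lemma eq_of_sub_mul_log_sub_log_eq_zero {x y : ℝ} (hx : 0 < x) (hy : 0 < y)
    (h : (x - y) * (Real.log x - Real.log y) = 0) : x = y := by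
  rcases mul_eq_zero.1 h with h | h
  · exact sub_eq_zero.1 h
  · exact Real.log_injOn_pos hx hy (sub_eq_zero.1 h)

lemma sum_mul_mul_sum_G_transpose (v x : Fin D → ℝ) :
    ∑ c, α c * v c * ∑ d, G α gᵀ d c * x d = ∑ d, α d * x d * ∑ c, G α g c d * v c := by
  simp only [Finset.mul_sum]
  rw [Finset.sum_comm]
  refine Finset.sum_congr rfl fun d _ => Finset.sum_congr rfl fun c _ => ?_
  linear_combination v c * x d * mul_G_transpose (α := α) (g := g) c d

namespace IsRealSolution

variable {τ τ₁ τ₂ t : ℝ} {v v₁ v₂ w w₁ w₂ : Fin D → ℝ}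

theorem sum_mul_eq_sum_mul (h : IsRealSolution α g τ t v w) (hα : ∀ c, 0 ≤ α c) (hτ : 0 ≤ τ)
    (ht : 0 < t) : ∑ c, α c * v c = ∑ c, α c * w c := by
  have eq : ∑ c, α c * v c * energy α gᵀ t w c = ∑ c, α c * w c * energy α g t v c := by
    simp only [mul_assoc, h.mul_energy_transpose hα hτ ht.le, h.mul_energy hα hτ ht.le]
  simp only [energy, mul_add, Finset.sum_add_distrib, ← Finset.sum_mul,
    sum_mul_mul_sum_G_transpose] at eq
  exact mul_right_cancel₀ ht.ne' (add_left_cancel eq)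

lemma log_energy_transpose (h : IsRealSolution α g τ t v w) (hα : ∀ c, 0 ≤ α c) (hτ : 0 < τ)
    (ht : 0 ≤ t) (c : Fin D) :
    Real.log (energy α gᵀ t w c)
      = Real.log τ + Real.log (w c) - Real.log (weight α g τ t v w c) := by
  have h_log := congrArg Real.log (h.weight_mul_energy_transpose c)
  rw [Real.log_mul (h.weight_pos hα hτ ht c).ne' (h.transpose.energy_pos hα ht c).ne',
    Real.log_mul hτ.ne' (h.pos_hat c).ne'] at h_log
  linarith

-- The log sum inequality for the two vectors `(Ĝ_dc w_d)_d` with common defect `t`, averaged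
-- over `c` with the weights `α_c v_c`; the mixed terms cancel because `α_c Ĝ_dc = α_d G_cd`.
lemma sum_one_sub_weight_mul_log_le (h₁ : IsRealSolution α g τ₁ t v₁ w₁)
    (h₂ : IsRealSolution α g τ₂ t v₂ w₂) (hα : ∀ c, 0 ≤ α c) (hτ₁ : 0 < τ₁) (hτ₂ : 0 < τ₂)
    (ht : 0 ≤ t) :
    ∑ c, α c * (1 - weight α g τ₁ t v₁ w₁ c) * (Real.log τ₁ - Real.log τ₂
        + Real.log (weight α g τ₂ t v₂ w₂ c) - Real.log (weight α g τ₁ t v₁ w₁ c))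
      ≤ -(t * ∑ c, α c * (w₁ c * (Real.log (w₁ c) - Real.log (w₂ c)))) := by
  set L : Fin D → ℝ := fun c => Real.log (w₁ c) - Real.log (w₂ c)
  have averaged : ∑ c, α c * v₁ c * (energy α gᵀ t w₁ c
        * (Real.log (energy α gᵀ t w₁ c) - Real.log (energy α gᵀ t w₂ c)))
      ≤ ∑ c, α c * v₁ c * ∑ d, G α gᵀ d c * (w₁ d * L d) :=
    Finset.sum_le_sum fun c _ => mul_le_mul_of_nonneg_left
      (log_sum_inequality (fun d => G_nonneg hα d c) h₁.pos_hat h₂.pos_hat ht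
        (h₁.transpose.energy_pos hα ht c) (h₂.transpose.energy_pos hα ht c) rfl rfl)
      (mul_nonneg (hα c) (h₁.pos c).le)
  have lhs (c : Fin D) : α c * v₁ c * (energy α gᵀ t w₁ c
        * (Real.log (energy α gᵀ t w₁ c) - Real.log (energy α gᵀ t w₂ c)))
      = α c * (1 - weight α g τ₁ t v₁ w₁ c) * (Real.log τ₁ - Real.log τ₂
        + Real.log (weight α g τ₂ t v₂ w₂ c) - Real.log (weight α g τ₁ t v₁ w₁ c))
        + α c * (1 - weight α g τ₁ t v₁ w₁ c) * L c := by
    rw [← h₁.mul_energy_transpose hα hτ₁.le ht, h₁.log_energy_transpose hα hτ₁ ht,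
      h₂.log_energy_transpose hα hτ₂ ht]
    ring
  have rhs : ∑ c, α c * v₁ c * ∑ d, G α gᵀ d c * (w₁ d * L d)
      = ∑ d, α d * (1 - weight α g τ₁ t v₁ w₁ d) * L d - t * ∑ d, α d * (w₁ d * L d) := by
    rw [sum_mul_mul_sum_G_transpose, Finset.mul_sum, ← Finset.sum_sub_distrib]
    refine Finset.sum_congr rfl fun d _ => ?_
    rw [← h₁.mul_energy hα hτ₁.le ht, energy]
    ring
  simp only [lhs, Finset.sum_add_distrib] at averaged
  linarith

lemma sum_sub_mul_log_le (h₁ : IsRealSolution α g τ₁ t v₁ w₁)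
    (h₂ : IsRealSolution α g τ₂ t v₂ w₂) (hα : ∀ c, 0 ≤ α c) (hτ₁ : 0 < τ₁) (hτ₂ : 0 < τ₂)
    (ht : 0 ≤ t) :
    ∑ c, α c * ((weight α g τ₁ t v₁ w₁ c - weight α g τ₂ t v₂ w₂ c)
          * (Real.log (weight α g τ₁ t v₁ w₁ c) - Real.log (weight α g τ₂ t v₂ w₂ c))
        + t * ((w₁ c - w₂ c) * (Real.log (w₁ c) - Real.log (w₂ c))))
      ≤ (meanWeight α g τ₁ t v₁ w₁ - meanWeight α g τ₂ t v₂ w₂)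
        * (Real.log τ₁ - Real.log τ₂) := by
  have h₁₂ := h₁.sum_one_sub_weight_mul_log_le h₂ hα hτ₁ hτ₂ ht
  have h₂₁ := h₂.sum_one_sub_weight_mul_log_le h₁ hα hτ₂ hτ₁ ht
  rw [meanWeight, meanWeight, ← Finset.sum_sub_distrib, Finset.sum_mul]
  rw [Finset.mul_sum] at h₁₂ h₂₁
  rw [← sub_nonneg, ← Finset.sum_sub_distrib]
  rw [← Finset.sum_neg_distrib, ← sub_nonneg, ← Finset.sum_sub_distrib] at h₁₂ h₂₁
  refine (add_nonneg h₁₂ h₂₁).trans_eq ?_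
  rw [← Finset.sum_add_distrib]
  exact Finset.sum_congr rfl fun c _ => by ring

lemma weight_eq_of_sum_nonpos (h₁ : IsRealSolution α g τ₁ t v₁ w₁)
    (h₂ : IsRealSolution α g τ₂ t v₂ w₂) (hα : ∀ c, 0 < α c) (hτ₁ : 0 < τ₁) (hτ₂ : 0 < τ₂)
    (ht : 0 ≤ t)
    (h : (meanWeight α g τ₁ t v₁ w₁ - meanWeight α g τ₂ t v₂ w₂)
      * (Real.log τ₁ - Real.log τ₂) ≤ 0) (c : Fin D) :
    weight α g τ₁ t v₁ w₁ c = weight α g τ₂ t v₂ w₂ c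
      ∧ t * (Real.log (w₁ c) - Real.log (w₂ c)) = 0 := by
  have hα' := fun c => (hα c).le
  have hq (c : Fin D) := sub_mul_log_sub_log_nonneg (h₁.weight_pos hα' hτ₁ ht c)
    (h₂.weight_pos hα' hτ₂ ht c)
  have hw (c : Fin D) := mul_nonneg ht
    (sub_mul_log_sub_log_nonneg (h₁.pos_hat c) (h₂.pos_hat c))
  have terms_nonneg (c : Fin D) := mul_nonneg (hα' c) (add_nonneg (hq c) (hw c))
  have term_eq_zero := (Finset.sum_eq_zero_iff_of_nonneg fun c _ => terms_nonneg c).1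
    (le_antisymm ((h₁.sum_sub_mul_log_le h₂ hα' hτ₁ hτ₂ ht).trans h)
      (Finset.sum_nonneg fun c _ => terms_nonneg c)) c (Finset.mem_univ c)
  obtain ⟨q_eq_zero, w_eq_zero⟩ := (add_eq_zero_iff_of_nonneg (hq c) (hw c)).1
    ((mul_eq_zero.1 term_eq_zero).resolve_left (hα c).ne')
  refine ⟨eq_of_sub_mul_log_sub_log_eq_zero (h₁.weight_pos hα' hτ₁ ht c)
    (h₂.weight_pos hα' hτ₂ ht c) q_eq_zero, ?_⟩
  rcases mul_eq_zero.1 w_eq_zero with ht0 | hw0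
  · rw [ht0, zero_mul]
  · rw [eq_of_sub_mul_log_sub_log_eq_zero (h₁.pos_hat c) (h₂.pos_hat c) hw0, sub_self, mul_zero]

theorem meanWeight_eq (h₁ : IsRealSolution α g τ t v₁ w₁) (h₂ : IsRealSolution α g τ t v₂ w₂)
    (hα : ∀ c, 0 < α c) (hτ : 0 < τ) (ht : 0 ≤ t) :
    meanWeight α g τ t v₁ w₁ = meanWeight α g τ t v₂ w₂ :=
  Finset.sum_congr rfl fun c _ => by
    rw [(h₁.weight_eq_of_sum_nonpos h₂ hα hτ hτ ht (by rw [sub_self, mul_zero]) c).1]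

theorem meanWeight_lt_meanWeight [Nonempty (Fin D)] (h₁ : IsRealSolution α g τ₁ t v₁ w₁)
    (h₂ : IsRealSolution α g τ₂ t v₂ w₂) (hα : ∀ c, 0 < α c) (hτ₁ : 0 < τ₁) (hτ : τ₁ < τ₂)
    (ht : 0 ≤ t) : meanWeight α g τ₁ t v₁ w₁ < meanWeight α g τ₂ t v₂ w₂ := by
  have hτ₂ := hτ₁.trans hτ
  have hα' := fun c => (hα c).le
  have log_lt : Real.log τ₁ < Real.log τ₂ := Real.log_lt_log hτ₁ hτ
  by_contra! hle
  have eq := h₁.weight_eq_of_sum_nonpos h₂ hα hτ₁ hτ₂ ht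
    (mul_nonpos_of_nonneg_of_nonpos (sub_nonneg.2 hle) (sub_nonpos.2 log_lt.le))
  have nonpos := h₂.sum_one_sub_weight_mul_log_le h₁ hα' hτ₂ hτ₁ ht
  have defect_eq_zero : t * ∑ c, α c * (w₂ c * (Real.log (w₂ c) - Real.log (w₁ c))) = 0 := by
    rw [Finset.mul_sum]
    exact Finset.sum_eq_zero fun c _ => by linear_combination -(α c * w₂ c) * (eq c).2
  simp only [defect_eq_zero, neg_zero, (eq _).1, add_sub_cancel_right] at nonpos
  exact nonpos.not_gt (Finset.sum_pos (fun c _ => mul_pos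
    (mul_pos (hα c) (sub_pos.2 (h₂.weight_lt_one hα' hτ₂.le ht c))) (sub_pos.2 log_lt))
    Finset.univ_nonempty)

end IsRealSolution

/-! ### Behaviour of the solutions as `t → 0` -/

lemma exists_sq_bounds [Nonempty (Fin D)] (hg : ∀ c d, 0 < g c d) :
    ∃ m M : ℝ, 0 < m ∧ 0 < M ∧ (∀ c d, m ≤ g c d ^ 2) ∧ ∀ c d, g c d ^ 2 ≤ M := by
  obtain ⟨i, hi⟩ := Finite.exists_min fun p : Fin D × Fin D => g p.1 p.2 ^ 2
  obtain ⟨j, hj⟩ := Finite.exists_max fun p : Fin D × Fin D => g p.1 p.2 ^ 2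
  exact ⟨_, _, pow_pos (hg i.1 i.2) 2, pow_pos (hg j.1 j.2) 2,
    fun c d => hi (c, d), fun c d => hj (c, d)⟩

lemma mul_sum_le_energy {m t : ℝ} {v : Fin D → ℝ} (hα : ∀ c, 0 ≤ α c) (hv : ∀ c, 0 ≤ v c)
    (ht : 0 ≤ t) (hm : ∀ c d, m ≤ g c d ^ 2) (c : Fin D) :
    m * ∑ d, α d * v d ≤ energy α g t v c := by
  refine le_add_of_le_of_nonneg ?_ ht
  rw [Finset.mul_sum]
  refine Finset.sum_le_sum fun d _ => ?_
  exact (mul_le_mul_of_nonneg_right (hm d c) (mul_nonneg (hα d) (hv d))).trans_eq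
    (by rw [G, Matrix.of_apply]; ring)

lemma energy_le_mul_sum_add {M : ℝ} {v : Fin D → ℝ} (hα : ∀ c, 0 ≤ α c) (hv : ∀ c, 0 ≤ v c)
    (hM : ∀ c d, g c d ^ 2 ≤ M) (t : ℝ) (c : Fin D) :
    energy α g t v c ≤ M * ∑ d, α d * v d + t := by
  rw [energy, Finset.mul_sum]
  refine add_le_add_left (Finset.sum_le_sum fun d _ => ?_) t
  refine Eq.trans_le ?_ (mul_le_mul_of_nonneg_right (hM d c) (mul_nonneg (hα d) (hv d)))
  rw [G, Matrix.of_apply]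
  ring

namespace IsRealSolution

variable {τ t m M k : ℝ} {v w x : Fin D → ℝ}

lemma sum_nonneg (h : IsRealSolution α g τ t v w) (hα : ∀ c, 0 ≤ α c) : 0 ≤ ∑ c, α c * v c :=
  Finset.sum_nonneg fun c _ => mul_nonneg (hα c) (h.pos c).le

lemma mul_le_sum (h : IsRealSolution α g τ t v w) (hα : ∀ c, 0 ≤ α c) (c : Fin D) :
    α c * v c ≤ ∑ d, α d * v d :=
  Finset.single_le_sum (f := fun d => α d * v d) (fun d _ => mul_nonneg (hα d) (h.pos d).le)
    (Finset.mem_univ c)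

lemma mul_sum_le_energy_transpose (h : IsRealSolution α g τ t v w) (hα : ∀ c, 0 ≤ α c)
    (hτ : 0 ≤ τ) (ht : 0 < t) (hm : ∀ c d, m ≤ g c d ^ 2) (c : Fin D) :
    m * ∑ d, α d * v d ≤ energy α gᵀ t w c := by
  rw [h.sum_mul_eq_sum_mul hα hτ ht]
  exact mul_sum_le_energy hα (fun d => (h.pos_hat d).le) ht.le (fun c d => hm d c) c

lemma energy_transpose_le_mul_sum_add (h : IsRealSolution α g τ t v w) (hα : ∀ c, 0 ≤ α c)
    (hτ : 0 ≤ τ) (ht : 0 < t) (hM : ∀ c d, g c d ^ 2 ≤ M) (c : Fin D) :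
    energy α gᵀ t w c ≤ M * ∑ d, α d * v d + t := by
  rw [h.sum_mul_eq_sum_mul hα hτ ht]
  exact energy_le_mul_sum_add hα (fun d => (h.pos_hat d).le) (fun c d => hM d c) t c

lemma sum_eigenvector_mul (h : IsRealSolution α g τ t v w) (hα : ∀ c, 0 ≤ α c) (hτ : 0 ≤ τ)
    (ht : 0 ≤ t) (hx : G α g *ᵥ x = k • x) :
    ∑ c, x c * v c * (τ - k + energy α gᵀ t w c * energy α g t v c) = t * ∑ c, x c := by
  have pairing : ∑ c, x c * energy α g t v c = ∑ d, v d * (G α g *ᵥ x) d + t * ∑ c, x c := by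
    simp only [energy, mul_add, Finset.sum_add_distrib, Finset.mul_sum, Matrix.mulVec, dotProduct]
    congr 1
    · rw [Finset.sum_comm]
      exact Finset.sum_congr rfl fun d _ => Finset.sum_congr rfl fun c _ => by ring
    · exact Finset.sum_congr rfl fun c _ => mul_comm _ _
  rw [hx, ← sub_eq_iff_eq_add', ← Finset.sum_sub_distrib] at pairing
  rw [← pairing]
  refine Finset.sum_congr rfl fun c _ => ?_
  have eq := h.eq c
  rw [realUpdate, eq_div_iff (h.denom_pos hα hτ ht c).ne'] at eq
  rw [Pi.smul_apply, smul_eq_mul]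
  linear_combination x c * eq

lemma sub_perronEigenvalue_le_sq [Nonempty (Fin D)] (h : IsRealSolution α g τ t v w)
    (hα : ∀ c, 0 < α c) (hg : ∀ c d, 0 < g c d) (hτ : 0 ≤ τ) (ht : 0 < t)
    (hM : ∀ c d, g c d ^ 2 ≤ M) :
    perronEigenvalue α g - τ ≤ (M * ∑ c, α c * v c + t) ^ 2 := by
  have hα' := fun c => (hα c).le
  obtain ⟨-, x, hx, hGx⟩ := exists_pos_perronEigenvector hα hg
  have sum_pos : ∑ _c : Fin D, (0 : ℝ) < ∑ c, x c * v c
      * (τ - perronEigenvalue α g + energy α gᵀ t w c * energy α g t v c) := by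
    rw [h.sum_eigenvector_mul hα' hτ ht.le hGx, Finset.sum_const_zero]
    exact mul_pos ht (Finset.sum_pos (fun c _ => hx c) Finset.univ_nonempty)
  obtain ⟨c, -, term_pos⟩ := Finset.exists_lt_of_sum_lt sum_pos
  have factor_pos := pos_of_mul_pos_right term_pos (mul_pos (hx c) (h.pos c)).le
  have energy_le := energy_le_mul_sum_add hα' (fun d => (h.pos d).le) hM t c
  have energy_pos := h.energy_pos hα' ht.le c
  have product_le := mul_le_mul (h.energy_transpose_le_mul_sum_add hα' hτ ht hM c) energy_le
    energy_pos.le (energy_pos.le.trans energy_le)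
  linarith

lemma sum_mul_le {p : ℝ} (h : IsRealSolution α g τ t v w) (hα : ∀ c, 0 ≤ α c) (hτ : 0 ≤ τ)
    (ht : 0 ≤ t) (hx_pos : ∀ c, 0 < x c) (hx : G α g *ᵥ x = k • x) (hp₀ : 0 ≤ p)
    (hp : ∀ c, p ≤ τ - k + energy α gᵀ t w c * energy α g t v c) :
    (∑ c, α c * v c) * p ≤ (∑ c, α c / x c) * (t * ∑ c, x c) := by
  have xv_nonneg (c : Fin D) : 0 ≤ x c * v c := (mul_pos (hx_pos c) (h.pos c)).le
  have term_le (c : Fin D) : x c * v c * p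
      ≤ x c * v c * (τ - k + energy α gᵀ t w c * energy α g t v c) :=
    mul_le_mul_of_nonneg_left (hp c) (xv_nonneg c)
  rw [← h.sum_eigenvector_mul hα hτ ht hx, Finset.sum_mul, Finset.sum_mul]
  refine Finset.sum_le_sum fun c _ => ?_
  calc α c * v c * p = α c / x c * (x c * v c * p) := by
        field_simp [(hx_pos c).ne']
    _ ≤ _ := mul_le_mul_of_nonneg_left ((term_le c).trans (Finset.single_le_sum
        (f := fun c => x c * v c * (τ - k + energy α gᵀ t w c * energy α g t v c))
        (fun d _ => (mul_nonneg (xv_nonneg d) hp₀).trans (term_le d)) (Finset.mem_univ c)))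
        (div_nonneg (hα c) (hx_pos c).le)

lemma sum_pow_three_le (h : IsRealSolution α g τ t v w) (hα : ∀ c, 0 ≤ α c) (hτ : 0 ≤ τ)
    (ht : 0 < t) (hk : k ≤ τ) (hx_pos : ∀ c, 0 < x c) (hx : G α g *ᵥ x = k • x)
    (hm₀ : 0 < m) (hm : ∀ c d, m ≤ g c d ^ 2) :
    (∑ c, α c * v c) ^ 3 ≤ (∑ c, α c / x c) * (t * ∑ c, x c) / m ^ 2 := by
  have mS_nonneg := mul_nonneg hm₀.le (h.sum_nonneg hα)
  rw [le_div_iff₀ (by positivity)]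
  refine Eq.trans_le ?_ (h.sum_mul_le hα hτ ht.le hx_pos hx (sq_nonneg (m * ∑ c, α c * v c))
    fun c => le_add_of_nonneg_of_le (sub_nonneg.2 hk) ?_)
  · ring
  · have mS_le := h.mul_sum_le_energy_transpose hα hτ ht hm c
    rw [sq]
    exact mul_le_mul mS_le (mul_sum_le_energy hα (fun d => (h.pos d).le) ht.le hm c) mS_nonneg
      (mS_nonneg.trans mS_le)

lemma bounds_of_energy_bounds {e B : ℝ} (h : IsRealSolution α g τ t v w) (hα : ∀ c, 0 ≤ α c)
    (hτ : 0 ≤ τ) (ht : 0 ≤ t) (he : 0 < e) (c : Fin D)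
    (h_energy : energy α g t v c ∈ Set.Icc e B) (h_hat : energy α gᵀ t w c ∈ Set.Icc e B) :
    v c ∈ Set.Icc (e / (τ + B * B)) (1 / e) := by
  constructor
  · rw [h.eq c]
    refine div_le_div₀ (he.le.trans h_energy.1) h_energy.1 (h.denom_pos hα hτ ht c) ?_
    gcongr
    · exact (he.le.trans h_energy.1)
    · exact he.le.trans (h_hat.1.trans h_hat.2)
    · exact h_hat.2
    · exact h_energy.2
  · rw [le_div_iff₀ he]
    refine (mul_le_mul_of_nonneg_left h_hat.1 (h.pos c).le).trans ?_
    rw [h.mul_energy_transpose hα hτ ht]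
    exact sub_le_self _ (h.weight_nonneg hα hτ ht c)

end IsRealSolution

theorem exists_eventually_le_sum [Nonempty (Fin D)] {τ : ℝ} (hα : ∀ c, 0 < α c)
    (hg : ∀ c d, 0 < g c d) (hτ : 0 ≤ τ) (hτ_lt : τ < perronEigenvalue α g) :
    ∃ C : ℝ, 0 < C ∧ ∀ᶠ t in 𝓝[>] (0 : ℝ), ∀ v w, IsRealSolution α g τ t v w →
      C ≤ ∑ c, α c * v c := by
  obtain ⟨-, M, -, hM, -, g_sq_le⟩ := exists_sq_bounds hg
  have gap_pos : 0 < √(perronEigenvalue α g - τ) := Real.sqrt_pos.2 (sub_pos.2 hτ_lt)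
  refine ⟨√(perronEigenvalue α g - τ) / 2 / M, by positivity, ?_⟩
  filter_upwards [Ioo_mem_nhdsGT (half_pos gap_pos)] with t ht v w h
  have gap_le := Real.sqrt_le_iff.2
    ⟨add_nonneg (mul_nonneg hM.le (h.sum_nonneg fun c => (hα c).le)) ht.1.le,
      h.sub_perronEigenvalue_le_sq hα hg hτ ht.1 g_sq_le⟩
  rw [div_le_iff₀ hM]
  linarith [ht.2]

theorem exists_eventually_mem_Icc [Nonempty (Fin D)] {τ : ℝ} (hα : ∀ c, 0 < α c)
    (hg : ∀ c d, 0 < g c d) (hτ : 0 ≤ τ) (hτ_lt : τ < perronEigenvalue α g) :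
    ∃ δ R : ℝ, 0 < δ ∧ ∀ᶠ t in 𝓝[>] (0 : ℝ), ∀ v w, IsRealSolution α g τ t v w →
      ∀ c, v c ∈ Set.Icc δ R ∧ w c ∈ Set.Icc δ R := by
  have hα' := fun c => (hα c).le
  obtain ⟨m, M, hm, hM, le_g_sq, g_sq_le⟩ := exists_sq_bounds hg
  obtain ⟨C, hC, eventually_le⟩ := exists_eventually_le_sum hα hg hτ hτ_lt
  set e := m * C
  have he : 0 < e := mul_pos hm hC
  set B := M * ∑ c, α c * (1 / e) + 1
  have sum_nonneg : 0 ≤ ∑ c, α c * (1 / e) :=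
    Finset.sum_nonneg fun c _ => mul_nonneg (hα' c) (one_div_pos.2 he).le
  have hB : 0 < B := by positivity
  refine ⟨e / (τ + B * B), 1 / e,
    div_pos he (add_pos_of_nonneg_of_pos hτ (mul_pos hB hB)), ?_⟩
  filter_upwards [eventually_le, Ioo_mem_nhdsGT (zero_lt_one' ℝ)] with t C_le ht v w h c
  have e_le := mul_le_mul_of_nonneg_left (C_le v w h) hm.le
  have e_le_energy (d : Fin D) : e ≤ energy α g t v d :=
    e_le.trans (mul_sum_le_energy hα' (fun d => (h.pos d).le) ht.1.le le_g_sq d)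
  have e_le_energy_transpose (d : Fin D) : e ≤ energy α gᵀ t w d :=
    e_le.trans (h.mul_sum_le_energy_transpose hα' hτ ht.1 le_g_sq d)
  have v_le (d : Fin D) : v d ≤ 1 / e := (h.bounds_of_energy_bounds hα' hτ ht.1.le he d
    ⟨e_le_energy d, le_max_left _ _⟩ ⟨e_le_energy_transpose d, le_max_right _ _⟩).2
  have sum_le : M * ∑ c, α c * v c + t ≤ B :=
    add_le_add (mul_le_mul_of_nonneg_left (Finset.sum_le_sum fun d _ =>
      mul_le_mul_of_nonneg_left (v_le d) (hα' d)) hM.le) ht.2.le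
  have energy_mem : energy α g t v c ∈ Set.Icc e B := ⟨e_le_energy c,
    (energy_le_mul_sum_add hα' (fun d => (h.pos d).le) g_sq_le t c).trans sum_le⟩
  have energy_transpose_mem : energy α gᵀ t w c ∈ Set.Icc e B := ⟨e_le_energy_transpose c,
    (h.energy_transpose_le_mul_sum_add hα' hτ ht.1 g_sq_le c).trans sum_le⟩
  exact ⟨h.bounds_of_energy_bounds hα' hτ ht.1.le he c energy_mem energy_transpose_mem,
    h.transpose.bounds_of_energy_bounds hα' hτ ht.1.le he c energy_transpose_mem energy_mem⟩

section Limits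

variable {ι : Type*} {l : Filter ι} {T : ι → ℝ} {τ t : ℝ} {v w : Fin D → ℝ}

lemma tendsto_energy {V : ι → Fin D → ℝ} (hT : Tendsto T l (𝓝 t)) (hV : Tendsto V l (𝓝 v))
    (c : Fin D) : Tendsto (fun i => energy α g (T i) (V i) c) l (𝓝 (energy α g t v c)) :=
  (tendsto_finsetSum _ fun d _ => (tendsto_pi_nhds.1 hV d).const_mul _).add hT

lemma tendsto_meanWeight {V W : ι → Fin D → ℝ} (hT : Tendsto T l (𝓝 t))
    (hV : Tendsto V l (𝓝 v)) (hW : Tendsto W l (𝓝 w))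
    (h0 : ∀ c, τ + energy α gᵀ t w c * energy α g t v c ≠ 0) :
    Tendsto (fun i => meanWeight α g τ (T i) (V i) (W i)) l (𝓝 (meanWeight α g τ t v w)) :=
  tendsto_finsetSum _ fun c _ => (tendsto_const_nhds.div (tendsto_const_nhds.add
    ((tendsto_energy hT hW c).mul (tendsto_energy hT hV c))) (h0 c)).const_mul _

lemma tendsto_realUpdate {V W : ι → Fin D → ℝ} (hT : Tendsto T l (𝓝 t))
    (hV : Tendsto V l (𝓝 v)) (hW : Tendsto W l (𝓝 w)) (c : Fin D)
    (h0 : τ + energy α gᵀ t w c * energy α g t v c ≠ 0) :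
    Tendsto (fun i => realUpdate α g τ (T i) (V i) (W i) c) l (𝓝 (realUpdate α g τ t v w c)) :=
  (tendsto_energy hT hV c).div (tendsto_const_nhds.add
    ((tendsto_energy hT hW c).mul (tendsto_energy hT hV c))) h0

lemma add_energy_mul_energy_pos (hα : ∀ c, 0 ≤ α c) (hτ : 0 < τ) (ht : 0 ≤ t)
    (hv : ∀ c, 0 ≤ v c) (hw : ∀ c, 0 ≤ w c) (c : Fin D) :
    0 < τ + energy α gᵀ t w c * energy α g t v c :=
  add_pos_of_pos_of_nonneg hτ
    (mul_nonneg (ht.trans (le_energy hα hw t c)) (ht.trans (le_energy hα hv t c)))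

lemma IsRealSolution.of_tendsto [l.NeBot] {V W : ι → Fin D → ℝ} (hα : ∀ c, 0 ≤ α c)
    (hτ : 0 < τ) (ht : 0 ≤ t) (hT : Tendsto T l (𝓝 t)) (hV : Tendsto V l (𝓝 v))
    (hW : Tendsto W l (𝓝 w)) (hv : ∀ c, 0 < v c) (hw : ∀ c, 0 < w c)
    (h : ∀ᶠ i in l, IsRealSolution α g τ (T i) (V i) (W i)) : IsRealSolution α g τ t v w := by
  have hv' := fun c => (hv c).le
  have hw' := fun c => (hw c).le
  refine ⟨hv, hw, fun c => ?_, fun c => ?_⟩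
  · refine tendsto_nhds_unique (tendsto_pi_nhds.1 hV c) ((tendsto_realUpdate hT hV hW c
      (add_energy_mul_energy_pos hα hτ ht hv' hw' c).ne').congr' ?_)
    filter_upwards [h] with i hi using (hi.eq c).symm
  · refine tendsto_nhds_unique (tendsto_pi_nhds.1 hW c) ((tendsto_realUpdate hT hW hV c
      (add_energy_mul_energy_pos hα hτ ht hw' hv' c).ne').congr' ?_)
    filter_upwards [h] with i hi using (hi.eq_hat c).symm

end Limits

section SmallT

variable [Nonempty (Fin D)] {τ : ℝ} {V W : ℝ → Fin D → ℝ}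

-- At the critical value `τ = λ` the linear bound on `S = ∑ c, α c * v c` degenerates, but the
-- product of the energies dominates a multiple of `S²`, which still yields `S³ = O(t)`.
theorem tendsto_sum_of_perronEigenvalue_le (hα : ∀ c, 0 < α c) (hg : ∀ c d, 0 < g c d)
    (hτ : perronEigenvalue α g ≤ τ) (h : ∀ t, 0 < t → IsRealSolution α g τ t (V t) (W t)) :
    Tendsto (fun t => ∑ c, α c * V t c) (𝓝[>] 0) (𝓝 0) := by
  have hα' := fun c => (hα c).le
  obtain ⟨perron_pos, x, hx, hGx⟩ := exists_pos_perronEigenvector hα hg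
  obtain ⟨m, -, hm, -, le_g_sq, -⟩ := exists_sq_bounds hg
  have sum_le {t : ℝ} (ht : 0 < t) : ∑ c, α c * V t c
      ≤ ((∑ c, α c / x c) * (t * ∑ c, x c) / m ^ 2) ^ ((3 : ℕ)⁻¹ : ℝ) := by
    have hS := (h t ht).sum_nonneg hα'
    rw [Real.le_rpow_inv_iff_of_pos hS ((pow_nonneg hS 3).trans ?_) (by norm_num),
      Real.rpow_natCast]
    all_goals exact (h t ht).sum_pow_three_le hα' (perron_pos.le.trans hτ) ht hτ hx hGx hm le_g_sq
  have bound_continuous : Continuous fun t : ℝ =>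
      ((∑ c, α c / x c) * (t * ∑ c, x c) / m ^ 2) ^ ((3 : ℕ)⁻¹ : ℝ) :=
    Continuous.rpow_const (by fun_prop) fun _ => Or.inr (by positivity)
  refine tendsto_of_tendsto_of_tendsto_of_le_of_le' tendsto_const_nhds
    (tendsto_nhdsWithin_of_tendsto_nhds (bound_continuous.tendsto' 0 0 ?_)) ?_ ?_
  · rw [zero_mul, mul_zero, zero_div, Real.zero_rpow (by norm_num)]
  all_goals filter_upwards [self_mem_nhdsWithin] with t ht
  · exact (h t ht).sum_nonneg hα'
  · exact sum_le ht

theorem tendsto_zero_of_perronEigenvalue_le (hα : ∀ c, 0 < α c) (hg : ∀ c d, 0 < g c d)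
    (hτ : perronEigenvalue α g ≤ τ) (h : ∀ t, 0 < t → IsRealSolution α g τ t (V t) (W t)) :
    Tendsto V (𝓝[>] 0) (𝓝 0) ∧ Tendsto W (𝓝[>] 0) (𝓝 0) := by
  have hα' := fun c => (hα c).le
  have hτ₀ := (exists_pos_perronEigenvector hα hg).1.le.trans hτ
  have tendsto_bound (c : Fin D) :
      Tendsto (fun t => (∑ d, α d * V t d) / α c) (𝓝[>] 0) (𝓝 0) := by
    simpa only [zero_div] using (tendsto_sum_of_perronEigenvalue_le hα hg hτ h).div_const (α c)
  constructor <;> refine tendsto_pi_nhds.2 fun c => tendsto_of_tendsto_of_tendsto_of_le_of_le'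
    tendsto_const_nhds (tendsto_bound c) ?_ ?_ <;> filter_upwards [self_mem_nhdsWithin] with t ht
  · exact ((h t ht).pos c).le
  · rw [le_div_iff₀' (hα c)]
    exact (h t ht).mul_le_sum hα' c
  · exact ((h t ht).pos_hat c).le
  · rw [le_div_iff₀' (hα c), (h t ht).sum_mul_eq_sum_mul hα' hτ₀ ht]
    exact (h t ht).transpose.mul_le_sum hα' c

theorem tendsto_meanWeight_one (hα : ∀ c, 0 < α c) (hsum : ∑ c, α c = 1)
    (hg : ∀ c d, 0 < g c d) (hτ : perronEigenvalue α g ≤ τ)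
    (h : ∀ t, 0 < t → IsRealSolution α g τ t (V t) (W t)) :
    Tendsto (fun t => meanWeight α g τ t (V t) (W t)) (𝓝[>] 0) (𝓝 1) := by
  obtain ⟨hV, hW⟩ := tendsto_zero_of_perronEigenvalue_le hα hg hτ h
  have hτ₀ : 0 < τ := (exists_pos_perronEigenvector hα hg).1.trans_le hτ
  have denom_eq (c : Fin D) : τ + energy α gᵀ 0 0 c * energy α g 0 0 c = τ := by
    simp only [energy, Pi.zero_apply, mul_zero, Finset.sum_const_zero, add_zero]
  have limit_eq : meanWeight α g τ 0 0 0 = 1 := by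
    simp only [meanWeight, weight, denom_eq, div_self hτ₀.ne', mul_one, hsum]
  rw [← limit_eq]
  exact tendsto_meanWeight (tendsto_nhdsWithin_of_tendsto_nhds tendsto_id) hV hW
    fun c => (denom_eq c).trans_ne hτ₀.ne'

lemma exists_tendsto_ultrafilter (hα : ∀ c, 0 < α c) (hg : ∀ c d, 0 < g c d) (hτ : 0 < τ)
    (hτ_lt : τ < perronEigenvalue α g) (h : ∀ t, 0 < t → IsRealSolution α g τ t (V t) (W t))
    (U : Ultrafilter ℝ) (hU : (U : Filter ℝ) ≤ 𝓝[>] 0) :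
    ∃ v w, IsRealSolution α g τ 0 v w ∧
      Tendsto (fun t => meanWeight α g τ t (V t) (W t)) U (𝓝 (meanWeight α g τ 0 v w)) := by
  have hα' := fun c => (hα c).le
  obtain ⟨δ, R, hδ, eventually_mem⟩ := exists_eventually_mem_Icc hα hg hτ.le hτ_lt
  have t_pos : ∀ᶠ t : ℝ in U, 0 < t := hU self_mem_nhdsWithin
  let box : Set (Fin D → ℝ) := Set.univ.pi fun _ => Set.Icc δ R
  have compact_box : IsCompact box := isCompact_univ_pi fun _ => isCompact_Icc
  have mem_box : ∀ᶠ t in U, (V t, W t) ∈ box ×ˢ box := by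
    filter_upwards [hU eventually_mem, t_pos] with t mem ht
    exact ⟨fun c _ => (mem _ _ (h t ht) c).1, fun c _ => (mem _ _ (h t ht) c).2⟩
  obtain ⟨⟨v, w⟩, ⟨hv, hw⟩, hlim⟩ := (compact_box.prod compact_box).ultrafilter_le_nhds
    (U.map fun t => (V t, W t)) (le_principal_iff.2 mem_box)
  have hV : Tendsto V U (𝓝 v) := (continuous_fst.tendsto _).comp (f := fun t => (V t, W t)) hlim
  have hW : Tendsto W U (𝓝 w) := (continuous_snd.tendsto _).comp (f := fun t => (V t, W t)) hlim
  have hT : Tendsto (fun t : ℝ => t) U (𝓝 0) := hU.trans nhdsWithin_le_nhds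
  have hvw : IsRealSolution α g τ 0 v w := .of_tendsto hα' hτ le_rfl hT hV hW
    (fun c => hδ.trans_le (hv c trivial).1) (fun c => hδ.trans_le (hw c trivial).1)
    (t_pos.mono h)
  exact ⟨v, w, hvw, tendsto_meanWeight hT hV hW
    fun c => (hvw.denom_pos hα' hτ.le le_rfl c).ne'⟩

-- The equations at `t = 0` determine `(v, w)` only up to the scaling `(s v, s⁻¹ w)`, so
-- `V` and `W` need not converge a priori; but all limit points have the same mean weight.
theorem exists_tendsto_meanWeight (hα : ∀ c, 0 < α c) (hg : ∀ c d, 0 < g c d) (hτ : 0 < τ)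
    (hτ_lt : τ < perronEigenvalue α g)
    (h : ∀ t, 0 < t → IsRealSolution α g τ t (V t) (W t)) :
    ∃ v w, IsRealSolution α g τ 0 v w ∧
      Tendsto (fun t => meanWeight α g τ t (V t) (W t)) (𝓝[>] 0)
        (𝓝 (meanWeight α g τ 0 v w)) := by
  obtain ⟨v, w, hvw, -⟩ := exists_tendsto_ultrafilter hα hg hτ hτ_lt h
    (Ultrafilter.of (𝓝[>] 0)) (Ultrafilter.of_le _)
  refine ⟨v, w, hvw, (tendsto_iff_ultrafilter _ _ _).2 fun U hU => ?_⟩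
  obtain ⟨v', w', hvw', hlim⟩ := exists_tendsto_ultrafilter hα hg hτ hτ_lt h U hU
  rwa [hvw.meanWeight_eq hvw' hα hτ le_rfl]

end SmallT

/-! ### The Wirtinger derivative in polar coordinates -/

section CircleAverage

variable {E : Type*} [NormedAddCommGroup E] [NormedSpace ℝ E] {f : ℂ → E} (c : ℂ)

lemma continuous_uncurry_circleMap : Continuous fun p : ℝ × ℝ => circleMap c p.1 p.2 := by
  unfold circleMap
  fun_prop

lemma continuous_fderiv_circleMap (hf : ContDiff ℝ 1 f) :
    Continuous fun p : ℝ × ℝ => fderiv ℝ f (circleMap c p.1 p.2) (circleMap 0 1 p.2) :=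
  ((hf.continuous_fderiv one_ne_zero).comp (continuous_uncurry_circleMap c)).clm_apply
    ((continuous_circleMap 0 1).comp continuous_snd)

lemma hasDerivAt_circleMap_radius (r θ : ℝ) :
    HasDerivAt (fun r : ℝ => circleMap c r θ) (circleMap 0 1 θ) r := by
  simpa only [circleMap, zero_add, Complex.ofRealCLM_apply, Complex.ofReal_one] using
    ((Complex.ofRealCLM.hasDerivAt (x := r)).mul_const (Complex.exp (θ * Complex.I))).const_add c

lemma hasDerivAt_circleAverage (hf : ContDiff ℝ 1 f) (r : ℝ) :
    HasDerivAt (Real.circleAverage f c) ((2 * Real.pi)⁻¹ •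
      ∫ θ in 0..2 * Real.pi, fderiv ℝ f (circleMap c r θ) (circleMap 0 1 θ)) r := by
  have continuous_comp (s : ℝ) : Continuous fun θ => f (circleMap c s θ) :=
    hf.continuous.comp (continuous_circleMap c s)
  have continuous_deriv : Continuous fun p : ℝ × ℝ =>
      fderiv ℝ f (circleMap c p.1 p.2) (circleMap 0 1 p.2) := continuous_fderiv_circleMap c hf
  obtain ⟨C, hC⟩ := ((isCompact_closedBall r 1).prod (isCompact_Icc (a := 0)
    (b := 2 * Real.pi))).exists_bound_of_continuousOn continuous_deriv.continuousOn
  suffices HasDerivAt (fun s => ∫ θ in 0..2 * Real.pi, f (circleMap c s θ))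
      (∫ θ in 0..2 * Real.pi, fderiv ℝ f (circleMap c r θ) (circleMap 0 1 θ)) r from
    this.const_smul (2 * Real.pi)⁻¹
  refine (intervalIntegral.hasDerivAt_integral_of_dominated_loc_of_deriv_le
    (F := fun s θ => f (circleMap c s θ))
    (F' := fun s θ => fderiv ℝ f (circleMap c s θ) (circleMap 0 1 θ)) (bound := fun _ => C)
    (Metric.closedBall_mem_nhds r one_pos) ?_ ?_ ?_ ?_ ?_ ?_).2
  · exact .of_forall fun s => (continuous_comp s).aestronglyMeasurable
  · exact (continuous_comp r).intervalIntegrable _ _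
  · exact (continuous_deriv.comp (Continuous.prodMk_right r)).aestronglyMeasurable
  · refine .of_forall fun θ hθ s hs => hC (s, θ) ⟨hs, ?_⟩
    rw [Set.uIoc_of_le Real.two_pi_pos.le] at hθ
    exact Set.Ioc_subset_Icc_self hθ
  · exact intervalIntegrable_const
  · exact .of_forall fun θ _ s _ => ((hf.differentiable one_ne_zero) _).hasFDerivAt.comp_hasDerivAt
      s (hasDerivAt_circleMap_radius c s θ)

lemma contDiff_circleAverage (hf : ContDiff ℝ 1 f) : ContDiff ℝ 1 (Real.circleAverage f c) := by
  have hasDerivAt := hasDerivAt_circleAverage c hf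
  refine contDiff_one_iff_deriv.2 ⟨fun r => (hasDerivAt r).differentiableAt, ?_⟩
  rw [funext fun r => (hasDerivAt r).deriv]
  exact (intervalIntegral.continuous_parametric_intervalIntegral_of_continuous'
    (f := fun r θ => fderiv ℝ f (circleMap c r θ) (circleMap 0 1 θ))
    (continuous_fderiv_circleMap c hf) 0 (2 * Real.pi)).const_smul _

lemma integral_fderiv_circleMap_mul_I [CompleteSpace E] (hf : ContDiff ℝ 1 f) (r : ℝ) :
    ∫ θ in 0..2 * Real.pi, fderiv ℝ f (circleMap c r θ) (circleMap 0 r θ * Complex.I) = 0 := by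
  rw [intervalIntegral.integral_eq_sub_of_hasDerivAt (f := fun θ => f (circleMap c r θ))
    (fun θ _ => ((hf.differentiable one_ne_zero) _).hasFDerivAt.comp_hasDerivAt θ
      (hasDerivAt_circleMap c r θ)) (Continuous.intervalIntegrable ?_ _ _)]
  · rw [(periodic_circleMap c r).eq, sub_self]
  · exact ((hf.continuous_fderiv one_ne_zero).comp (continuous_circleMap c r)).clm_apply
      ((continuous_circleMap 0 r).mul continuous_const)

lemma hasCompactSupport_circleAverage (hf : HasCompactSupport f) :
    HasCompactSupport (Real.circleAverage f 0) := by
  obtain ⟨R, hR⟩ := hf.isCompact.isBounded.subset_closedBall 0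
  refine HasCompactSupport.intro (isCompact_closedBall (0 : ℝ) R) fun r hr => ?_
  have vanishes (θ : ℝ) : f (circleMap 0 r θ) = 0 := by
    refine image_eq_zero_of_notMem_tsupport fun mem => hr ?_
    have norm_le := hR mem
    rwa [mem_closedBall_zero_iff, norm_circleMap_zero, ← Real.norm_eq_abs,
      ← mem_closedBall_zero_iff] at norm_le
  simp only [Real.circleAverage, vanishes, intervalIntegral.integral_zero, smul_zero]

end CircleAverage

lemma mul_wirtinger (φ : ℂ → ℂ) (w z : ℂ) :
    w * wirtinger φ z = 1 / 2 * (fderiv ℝ φ z w - Complex.I * fderiv ℝ φ z (w * Complex.I)) := by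
  have w_eq : w = w.re • (1 : ℂ) + w.im • Complex.I := by
    simp only [Complex.real_smul, mul_one, Complex.re_add_im]
  have wI_eq : w * Complex.I = w.re • Complex.I - w.im • (1 : ℂ) := by
    nth_rewrite 1 [w_eq]
    simp only [Complex.real_smul]
    linear_combination (w.im : ℂ) * Complex.I_mul_I
  rw [wirtinger, wI_eq, map_sub, map_smul, map_smul]
  nth_rewrite 1 2 [w_eq]
  rw [map_add, map_smul, map_smul]
  simp only [Complex.real_smul]
  linear_combination (-(1 / 2) * (w.im : ℂ) * fderiv ℝ φ z Complex.I) * Complex.I_mul_I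

section RadialPairing

variable {φ : ℂ → ℂ} (hφ : ContDiff ℝ 1 φ)
include hφ

lemma continuous_wirtinger : Continuous (wirtinger φ) := by
  have := hφ.continuous_fderiv one_ne_zero
  unfold wirtinger
  fun_prop

-- In polar coordinates `exp (iθ) ∂_z = (∂_r - (i / r) ∂_θ) / 2`, and the angular derivative
-- integrates to zero over a circle.
lemma integral_circleMap_mul_wirtinger {r : ℝ} (hr : r ≠ 0) :
    ∫ θ in 0..2 * Real.pi, circleMap 0 1 θ * wirtinger φ (circleMap 0 r θ)
      = Real.pi * deriv (Real.circleAverage φ 0) r := by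
  have : Continuous fun θ => fderiv ℝ φ (circleMap 0 r θ) :=
    (hφ.continuous_fderiv one_ne_zero).comp (continuous_circleMap 0 r)
  have angular : ∫ θ in 0..2 * Real.pi,
      fderiv ℝ φ (circleMap 0 r θ) (circleMap 0 1 θ * Complex.I) = 0 := by
    have scaled := integral_fderiv_circleMap_mul_I 0 hφ r
    have circleMap_eq (θ : ℝ) : circleMap 0 r θ * Complex.I
        = r • (circleMap 0 1 θ * Complex.I) := by
      simp only [circleMap, Complex.real_smul, Complex.ofReal_one]
      ring
    simp only [circleMap_eq, map_smul] at scaled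
    rw [intervalIntegral.integral_smul] at scaled
    exact (smul_eq_zero.1 scaled).resolve_left hr
  simp only [mul_wirtinger]
  rw [intervalIntegral.integral_const_mul, intervalIntegral.integral_sub,
    intervalIntegral.integral_const_mul, angular, (hasDerivAt_circleAverage 0 hφ r).deriv,
    Complex.real_smul]
  · push_cast
    field_simp
    ring
  all_goals exact Continuous.intervalIntegrable (by fun_prop) _ _

lemma integrableOn_mul_wirtinger_circleMap (hc : HasCompactSupport φ) {k : ℝ → ℝ}
    (hk : Measurable k) {C : ℝ} (hC : ∀ r, |k r| ≤ C) :
    IntegrableOn (fun p : ℝ × ℝ =>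
      k p.1 • (circleMap 0 1 p.2 * wirtinger φ (circleMap 0 p.1 p.2))) polarCoord.target := by
  obtain ⟨R, hR⟩ := hc.isCompact.isBounded.subset_closedBall 0
  have continuous_pairing : Continuous fun p : ℝ × ℝ =>
      circleMap 0 1 p.2 * wirtinger φ (circleMap 0 p.1 p.2) :=
    ((continuous_circleMap 0 1).comp continuous_snd).mul
      ((continuous_wirtinger hφ).comp (continuous_uncurry_circleMap 0))
  suffices IntegrableOn (fun p : ℝ × ℝ =>
      circleMap 0 1 p.2 * wirtinger φ (circleMap 0 p.1 p.2)) polarCoord.target from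
    this.bdd_smul C (hk.comp measurable_fst).aestronglyMeasurable (.of_forall fun p => hC p.1)
  refine (continuous_pairing.continuousOn.integrableOn_compact
    (isCompact_Icc.prod isCompact_Icc : IsCompact (Set.Icc 0 R ×ˢ Set.Icc (-Real.pi) Real.pi)))
    |>.of_forall_sdiff_eq_zero polarCoord.open_target.measurableSet ?_
  rintro ⟨r, θ⟩ ⟨⟨hr, hθ⟩, outside⟩
  have notMem : circleMap 0 r θ ∉ tsupport φ := fun mem => outside <| by
    have norm_le := hR mem
    rw [mem_closedBall_zero_iff, norm_circleMap_zero, abs_of_pos hr] at norm_le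
    exact ⟨⟨hr.le, norm_le⟩, Set.Ioo_subset_Icc_self hθ⟩
  simp only [wirtinger, fderiv_of_notMem_tsupport ℝ notMem, zero_apply, mul_zero, sub_zero]

lemma integral_radial_mul_wirtinger (hc : HasCompactSupport φ) {k : ℝ → ℝ} (hk : Measurable k)
    {C : ℝ} (hC : ∀ r, |k r| ≤ C) :
    ∫ z : ℂ, -z / (‖z‖ : ℂ) ^ 2 * k ‖z‖ * wirtinger φ z
      = -Real.pi * ∫ r in Set.Ioi 0, k r • deriv (Real.circleAverage φ 0) r := by
  have integrand_eq : ∀ p ∈ polarCoord.target, p.1 • (-Complex.polarCoord.symm p /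
      (‖Complex.polarCoord.symm p‖ : ℂ) ^ 2 * k ‖Complex.polarCoord.symm p‖ *
        wirtinger φ (Complex.polarCoord.symm p))
      = -(k p.1 • (circleMap 0 1 p.2 * wirtinger φ (circleMap 0 p.1 p.2))) := by
    rintro ⟨r, θ⟩ ⟨hr : 0 < r, -⟩
    have symm_eq : Complex.polarCoord.symm (r, θ) = circleMap 0 r θ := by
      rw [Complex.polarCoord_symm_apply, circleMap_zero, Complex.exp_mul_I, Complex.ofReal_cos,
        Complex.ofReal_sin]
    have hr' : (r : ℂ) ≠ 0 := Complex.ofReal_ne_zero.2 hr.ne'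
    simp only [symm_eq, norm_circleMap_zero, abs_of_pos hr, Complex.real_smul]
    simp only [circleMap_zero, Complex.ofReal_one, one_mul]
    field_simp
  have integral_angle (r : ℝ) (hr : 0 < r) : ∫ θ in Set.Ioo (-Real.pi) Real.pi,
      k r • (circleMap 0 1 θ * wirtinger φ (circleMap 0 r θ))
        = Real.pi * (k r • deriv (Real.circleAverage φ 0) r) := by
    have periodic : Function.Periodic
        (fun θ => circleMap 0 1 θ * wirtinger φ (circleMap 0 r θ)) (2 * Real.pi) := fun θ => by
      simp only [periodic_circleMap 0 _ θ]
    rw [integral_smul, ← integral_Ioc_eq_integral_Ioo, ← intervalIntegral.integral_of_le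
      (by linarith [Real.pi_pos]), mul_smul_comm,
      ← integral_circleMap_mul_wirtinger hφ hr.ne', ← zero_add (2 * Real.pi),
      ← periodic.intervalIntegral_add_eq (-Real.pi) 0]
    ring_nf
  rw [← Complex.integral_comp_polarCoord_symm, setIntegral_congr_fun
    polarCoord.open_target.measurableSet integrand_eq, integral_neg]
  have integrable := integrableOn_mul_wirtinger_circleMap hφ hc hk hC
  rw [polarCoord_target] at integrable ⊢
  rw [Measure.volume_eq_prod] at integrable ⊢
  rw [setIntegral_prod _ integrable, setIntegral_congr_fun measurableSet_Ioi integral_angle,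
    integral_const_mul, neg_mul]

end RadialPairing

/-! ### Radial measures -/

lemma integral_stieltjes_eq_neg_integral_smul_deriv {E : Type*} [NormedAddCommGroup E]
    [NormedSpace ℝ E] [CompleteSpace E] (F : StieltjesFunction ℝ) [IsFiniteMeasure F.measure]
    (hF : Tendsto F atBot (𝓝 0)) {ψ : ℝ → E} (hψ : ContDiff ℝ 1 ψ) (hc : HasCompactSupport ψ) :
    ∫ x, ψ x ∂F.measure = -∫ u, F u • deriv ψ u := by
  have integrable : Integrable (Function.uncurry fun x u => (Set.Ici x).indicator (deriv ψ) u)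
      (F.measure.prod volume) := by
    have integrable_deriv : Integrable (deriv ψ) :=
      (hψ.continuous_deriv le_rfl).integrable_of_hasCompactSupport hc.deriv
    exact (integrable_deriv.comp_snd (ν := volume) F.measure).indicator
      (measurableSet_le measurable_fst measurable_snd)
  have measureReal_Iic (u : ℝ) : F.measure.real (Set.Iic u) = F u := by
    rw [measureReal_def, F.measure_Iic hF, sub_zero,
      ENNReal.toReal_ofReal (F.mono.le_of_tendsto hF u)]
  calc ∫ x, ψ x ∂F.measure = ∫ x, -(∫ u, (Set.Ici x).indicator (deriv ψ) u) ∂F.measure := by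
        refine integral_congr_ae (.of_forall fun x => ?_)
        beta_reduce
        rw [integral_indicator measurableSet_Ici, integral_Ici_eq_integral_Ioi,
          hc.integral_Ioi_deriv_eq hψ, neg_neg]
    _ = -∫ u, ∫ x, (Set.Iic u).indicator (fun _ => deriv ψ u) x ∂F.measure := by
        rw [integral_neg, integral_integral_swap integrable]
        rfl
    _ = -∫ u, F u • deriv ψ u := by
        simp only [integral_indicator measurableSet_Iic, setIntegral_const, measureReal_Iic]

local instance : Fact (0 < 2 * Real.pi) := ⟨Real.two_pi_pos⟩

/-- The rotation invariant measure on `ℂ` under which the modulus has distribution `ρ` and the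
argument is independent of the modulus and uniform. -/
noncomputable def radialMeasure (ρ : Measure ℝ) : Measure ℂ :=
  (ρ.prod AddCircle.haarAddCircle).map
    fun p : ℝ × AddCircle (2 * Real.pi) => p.1 * (AddCircle.toCircle p.2 : ℂ)

lemma continuous_mul_toCircle :
    Continuous fun p : ℝ × AddCircle (2 * Real.pi) => (p.1 * (AddCircle.toCircle p.2 : ℂ) : ℂ) :=
  (Complex.continuous_ofReal.comp continuous_fst).mul
    (continuous_subtype_val.comp (AddCircle.continuous_toCircle.comp continuous_snd))

instance (ρ : Measure ℝ) [IsProbabilityMeasure ρ] : IsProbabilityMeasure (radialMeasure ρ) :=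
  Measure.isProbabilityMeasure_map continuous_mul_toCircle.aemeasurable

lemma integral_haarAddCircle_mul_toCircle {E : Type*} [NormedAddCommGroup E] [NormedSpace ℝ E]
    (f : ℂ → E) (r : ℝ) :
    ∫ x, f (r * (AddCircle.toCircle x : ℂ)) ∂(AddCircle.haarAddCircle (T := 2 * Real.pi))
      = Real.circleAverage f 0 r := by
  rw [AddCircle.integral_haarAddCircle, Real.circleAverage,
    ← AddCircle.intervalIntegral_preimage (2 * Real.pi) 0]
  simp [AddCircle.toCircle, circleMap]

lemma integral_radialMeasure {E : Type*} [NormedAddCommGroup E] [NormedSpace ℝ E]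
    (ρ : Measure ℝ) [IsFiniteMeasure ρ] {f : ℂ → E} (hf : Continuous f) (hc : HasCompactSupport f) :
    ∫ z, f z ∂radialMeasure ρ = ∫ r, Real.circleAverage f 0 r ∂ρ := by
  have : SecondCountableTopology (AddCircle (2 * Real.pi)) := inferInstance
  obtain ⟨C, hC⟩ := hf.bounded_above_of_compact_support hc
  have integrable : Integrable (fun p : ℝ × AddCircle (2 * Real.pi) =>
      f (p.1 * (AddCircle.toCircle p.2 : ℂ))) (ρ.prod AddCircle.haarAddCircle) :=
    .of_bound (hf.comp continuous_mul_toCircle).aestronglyMeasurable C (.of_forall fun p => hC _)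
  rw [radialMeasure, integral_map continuous_mul_toCircle.aemeasurable
    hf.aestronglyMeasurable, integral_prod _ integrable]
  simp only [integral_haarAddCircle_mul_toCircle]

lemma exists_norm_mul_toCircle_eq (z : ℂ) :
    ∃ s : AddCircle (2 * Real.pi), (‖z‖ * (AddCircle.toCircle s : ℂ) : ℂ) = z := by
  refine ⟨(Complex.arg z : ℝ), ?_⟩
  rw [AddCircle.toCircle_apply_mk, div_self Real.two_pi_pos.ne', one_mul, Circle.coe_exp,
    Complex.norm_mul_exp_arg_mul_I]

lemma map_mul_radialMeasure (ρ : Measure ℝ) [SFinite ρ] {w : ℂ} (hw : ‖w‖ = 1) :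
    (radialMeasure ρ).map (fun z => w * z) = radialMeasure ρ := by
  obtain ⟨s, hs⟩ := exists_norm_mul_toCircle_eq w
  rw [hw, Complex.ofReal_one, one_mul] at hs
  have map_rotation : (ρ.prod (AddCircle.haarAddCircle (T := 2 * Real.pi))).map
      (Prod.map id (s + ·)) = ρ.prod AddCircle.haarAddCircle := by
    rw [← Measure.map_prod_map _ _ measurable_id (measurable_const_add s), Measure.map_id,
      map_add_left_eq_self]
  rw [radialMeasure, Measure.map_map (measurable_const_mul w) continuous_mul_toCircle.measurable]
  nth_rewrite 2 [← map_rotation]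
  rw [Measure.map_map continuous_mul_toCircle.measurable
    (measurable_id.prodMap (measurable_const_add s))]
  congr 1
  ext p
  simp only [Function.comp_apply, Prod.map_fst, Prod.map_snd, id_eq, AddCircle.toCircle_add,
    Circle.coe_mul, hs]
  ring

lemma support_radialMeasure {ρ : Measure ℝ} (hρ : ρ (Set.Iio 0) = 0) :
    (radialMeasure ρ).support = {z | ‖z‖ ∈ ρ.support} := by
  ext z
  constructor
  · refine not_imp_not.1 fun notMem : ‖z‖ ∉ ρ.support => (?_ : z ∉ (radialMeasure ρ).support)
    obtain ⟨U, hU, hUρ⟩ := Measure.notMem_support_iff_exists.1 notMem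
    obtain ⟨V, hVU, hV, mem_V⟩ := mem_nhds_iff.1 hU
    refine Measure.notMem_support_iff_exists.2 ⟨norm ⁻¹' V,
      (hV.preimage continuous_norm).mem_nhds mem_V, ?_⟩
    have preimage_subset : (fun p : ℝ × AddCircle (2 * Real.pi) =>
        (p.1 * (AddCircle.toCircle p.2 : ℂ) : ℂ)) ⁻¹' (norm ⁻¹' V)
          ⊆ (Set.Iio 0 ∪ U) ×ˢ Set.univ := by
      rintro ⟨r, s⟩ hp
      refine ⟨or_iff_not_imp_left.2 fun hr => hVU ?_, Set.mem_univ s⟩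
      simpa only [Set.mem_preimage, norm_mul, Circle.norm_coe, mul_one, Complex.norm_real,
        Real.norm_of_nonneg (not_lt.1 hr)] using hp
    rw [radialMeasure, Measure.map_apply continuous_mul_toCircle.measurable
      (hV.preimage continuous_norm).measurableSet]
    refine measure_mono_null preimage_subset ?_
    rw [Measure.prod_prod, measure_union_null hρ hUρ, zero_mul]
  · intro mem
    obtain ⟨s, hs⟩ := exists_norm_mul_toCircle_eq z
    refine (Measure.mem_support_iff_forall z).2 fun U hU => ?_
    have preimage_mem := continuous_mul_toCircle.continuousAt.preimage_mem_nhds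
      (x := (‖z‖, s)) (by rwa [hs])
    obtain ⟨A, hA, B, hB, prod_subset⟩ := mem_nhds_prod_iff.1 preimage_mem
    calc 0 < ρ A * AddCircle.haarAddCircle B :=
          ENNReal.mul_pos ((Measure.mem_support_iff_forall _).1 mem A hA).ne'
            (Measure.measure_pos_of_mem_nhds _ hB).ne'
      _ = (ρ.prod AddCircle.haarAddCircle) (A ×ˢ B) := (Measure.prod_prod A B).symm
      _ ≤ radialMeasure ρ U := (measure_mono prod_subset).trans
          (Measure.le_map_apply continuous_mul_toCircle.aemeasurable U)

lemma support_stieltjes_measure {F : StieltjesFunction ℝ} {a b l u : ℝ} (hab : a < b)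
    (hl : ∀ r < a, F r = l) (hu : ∀ r, b ≤ r → F r = u) (hF : StrictMonoOn F (Set.Ioo a b)) :
    F.measure.support = Set.Icc a b := by
  refine Set.Subset.antisymm ?_ ?_
  · have tendsto_bot : Tendsto F atBot (𝓝 l) :=
      tendsto_const_nhds.congr' ((eventually_lt_atBot a).mono fun r hr => (hl r hr).symm)
    have tendsto_top : Tendsto F atTop (𝓝 u) :=
      tendsto_const_nhds.congr' ((eventually_ge_atTop b).mono fun r hr => (hu r hr).symm)
    have leftLim_eq : Function.leftLim F a = l := leftLim_eq_of_tendsto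
      (tendsto_const_nhds.congr' (eventually_mem_nhdsWithin.mono fun r hr => (hl r hr).symm))
    refine Measure.support_subset_of_isClosed isClosed_Icc (mem_ae_iff.2 ?_)
    rw [← Set.Ici_inter_Iic, Set.compl_inter, Set.compl_Ici, Set.compl_Iic]
    refine measure_union_null ?_ ?_
    · rw [F.measure_Iio tendsto_bot, leftLim_eq, sub_self, ENNReal.ofReal_zero]
    · rw [F.measure_Ioi tendsto_top, hu b le_rfl, sub_self, ENNReal.ofReal_zero]
  · rw [← closure_Ioo hab.ne]
    refine closure_minimal (fun r hr => (Measure.mem_support_iff_forall r).2 fun U hU => ?_)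
      Measure.isClosed_support
    obtain ⟨x, y, ⟨hx, hy⟩, Ioo_subset⟩ := mem_nhds_iff_exists_Ioo_subset.1
      (inter_mem hU (Ioo_mem_nhds hr.1 hr.2))
    obtain ⟨m, hrm, hmy⟩ := exists_between hy
    calc 0 < F.measure (Set.Ioc r m) := by
          rw [F.measure_Ioc, ENNReal.ofReal_pos, sub_pos]
          exact hF hr (Ioo_subset ⟨hx.trans hrm, hmy⟩).2 hrm
      _ ≤ F.measure U := measure_mono fun s hs =>
          (Ioo_subset ⟨hx.trans hs.1, hs.2.trans_lt hmy⟩).1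

lemma ext_of_forall_integral_contDiff_eq {E : Type*} [NormedAddCommGroup E] [NormedSpace ℝ E]
    [FiniteDimensional ℝ E] [MeasurableSpace E] [BorelSpace E] {μ ν : Measure E}
    [IsFiniteMeasure μ] [IsFiniteMeasure ν]
    (h : ∀ φ : E → ℝ, ContDiff ℝ ∞ φ → HasCompactSupport φ → ∫ x, φ x ∂μ = ∫ x, φ x ∂ν) :
    μ = ν := by
  have μ_ac : μ ≪ μ + ν := Measure.AbsolutelyContinuous.rfl.add_right ν
  have ν_ac : ν ≪ μ + ν := Measure.absolutelyContinuous_of_le (Measure.le_add_left le_rfl)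
  have integrable_smul (ρ : Measure E) [IsFiniteMeasure ρ] (ρ_ac : ρ ≪ μ + ν) {φ : E → ℝ}
      (hφ : ContDiff ℝ ∞ φ) (hc : HasCompactSupport φ) :
      Integrable (fun x => (ρ.rnDeriv (μ + ν) x).toReal • φ x) (μ + ν) :=
    (integrable_rnDeriv_smul_iff ρ_ac).2 (hφ.continuous.integrable_of_hasCompactSupport hc)
  have densities_eq : ∀ᵐ x ∂(μ + ν),
      (μ.rnDeriv (μ + ν) x).toReal - (ν.rnDeriv (μ + ν) x).toReal = 0 := by
    refine ae_eq_zero_of_integral_contDiff_smul_eq_zero (Integrable.sub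
      Measure.integrable_toReal_rnDeriv Measure.integrable_toReal_rnDeriv).locallyIntegrable
      fun φ hφ hc => ?_
    simp only [smul_eq_mul, mul_comm (φ _)]
    simp only [← smul_eq_mul, sub_smul]
    rw [integral_sub (integrable_smul μ μ_ac hφ hc) (integrable_smul ν ν_ac hφ hc),
      integral_rnDeriv_smul μ_ac, integral_rnDeriv_smul ν_ac, h φ hφ hc, sub_self]
  refine (Measure.withDensity_rnDeriv_eq μ _ μ_ac).symm.trans
    (.trans (withDensity_congr_ae ?_) (Measure.withDensity_rnDeriv_eq ν _ ν_ac))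
  filter_upwards [densities_eq, μ.rnDeriv_lt_top (μ + ν), ν.rnDeriv_lt_top (μ + ν)]
    with x difference_eq_zero μ_lt_top ν_lt_top
  exact (ENNReal.toReal_eq_toReal_iff' μ_lt_top.ne ν_lt_top.ne).1 (sub_eq_zero.1 difference_eq_zero)

lemma tendsto_integral_radial {k : ℝ → ℝ → ℝ} {F : StieltjesFunction ℝ}
    (hF₀ : ∀ r < 0, F r = 0) [IsFiniteMeasure F.measure]
    (hk : ∀ t, 0 < t → Measurable (k t)) {C : ℝ} (hC : ∀ t, 0 < t → ∀ r, |k t r| ≤ C)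
    (hlim : ∀ᵐ r ∂volume.restrict (Set.Ioi (0 : ℝ)), Tendsto (k · r) (𝓝[>] 0) (𝓝 (F r)))
    {φ : ℂ → ℂ} (hφ : ContDiff ℝ 1 φ) (hc : HasCompactSupport φ) :
    Tendsto (fun t : ℝ => (1 / (Real.pi : ℂ)) *
        ∫ z : ℂ, -z / (‖z‖ : ℂ) ^ 2 * k t ‖z‖ * wirtinger φ z) (𝓝[>] 0)
      (𝓝 (∫ z, φ z ∂radialMeasure F.measure)) := by
  have contDiff_average := contDiff_circleAverage 0 hφ
  have compact_average := hasCompactSupport_circleAverage hc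
  have pos : ∀ᶠ t : ℝ in 𝓝[>] 0, 0 < t := eventually_mem_nhdsWithin
  have tendsto_bot : Tendsto F atBot (𝓝 0) :=
    tendsto_const_nhds.congr' ((eventually_lt_atBot 0).mono fun r hr => (hF₀ r hr).symm)
  have integral_eq : ∫ z, φ z ∂radialMeasure F.measure
      = -∫ r in Set.Ioi 0, F r • deriv (Real.circleAverage φ 0) r := by
    rw [integral_radialMeasure _ hφ.continuous hc,
      integral_stieltjes_eq_neg_integral_smul_deriv F tendsto_bot contDiff_average compact_average,
      ← integral_Ici_eq_integral_Ioi, setIntegral_eq_integral_of_forall_compl_eq_zero]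
    intro r hr
    rw [hF₀ r (not_le.1 hr), zero_smul]
  have tendsto_integral : Tendsto
      (fun t => ∫ r in Set.Ioi 0, k t r • deriv (Real.circleAverage φ 0) r) (𝓝[>] 0)
      (𝓝 (∫ r in Set.Ioi 0, F r • deriv (Real.circleAverage φ 0) r)) := by
    have continuous_deriv := contDiff_average.continuous_deriv le_rfl
    refine tendsto_integral_filter_of_dominated_convergence
      (fun r => C * ‖deriv (Real.circleAverage φ 0) r‖) ?_ ?_ ?_ ?_
    · filter_upwards [pos] with t ht
      exact (hk t ht).aestronglyMeasurable.smul continuous_deriv.aestronglyMeasurable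
    · filter_upwards [pos] with t ht
      refine .of_forall fun r => ?_
      rw [norm_smul]
      exact mul_le_mul_of_nonneg_right (hC t ht r) (norm_nonneg _)
    · exact ((continuous_deriv.integrable_of_hasCompactSupport
        compact_average.deriv).norm.const_mul C).restrict
    · filter_upwards [hlim] with r hr using hr.smul_const _
  rw [integral_eq]
  refine tendsto_integral.neg.congr' ?_
  filter_upwards [pos] with t ht
  rw [integral_radial_mul_wirtinger hφ hc (hk t ht) (hC t ht)]
  field_simp

/-! ### The limiting measure -/

lemma IsSolution.eq_realSolution {z : ℂ} {t : ℝ} {a a' : Fin D → ℂ}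
    (h : IsSolution α g z (t * Complex.I) a a') (hα : ∀ c, 0 ≤ α c) (ht : 0 < t) :
    (a = fun d => (realSolution α g (‖z‖ ^ 2) t).1 d * Complex.I) ∧
      a' = fun d => (realSolution α g (‖z‖ ^ 2) t).2 d * Complex.I :=
  h.unique hα (by simpa using ht) (isRealSolution_realSolution hα (sq_nonneg ‖z‖) ht).isSolution

/-- The mean weight of the solution at `|z| = r` and `η = i t`, extended by `0` to `r ≤ 0`. Its
limit as `t → 0` is, up to right continuity, the distribution function of `|z|` under the limiting
measure. -/
noncomputable def profile (α : Fin D → ℝ) (g : Matrix (Fin D) (Fin D) ℝ) (t r : ℝ) : ℝ :=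
  if r ≤ 0 then 0
  else meanWeight α g (r ^ 2) t (realSolution α g (r ^ 2) t).1 (realSolution α g (r ^ 2) t).2

lemma profile_of_nonpos {t r : ℝ} (hr : r ≤ 0) : profile α g t r = 0 := if_pos hr

lemma profile_of_pos {t r : ℝ} (hr : 0 < r) : profile α g t r =
    meanWeight α g (r ^ 2) t (realSolution α g (r ^ 2) t).1 (realSolution α g (r ^ 2) t).2 :=
  if_neg (not_le.2 hr)

lemma profile_nonneg (hα : ∀ c, 0 ≤ α c) {t : ℝ} (ht : 0 < t) (r : ℝ) : 0 ≤ profile α g t r := by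
  rcases le_or_gt r 0 with hr | hr
  · rw [profile_of_nonpos hr]
  · rw [profile_of_pos hr]
    exact (isRealSolution_realSolution hα (sq_nonneg r) ht).meanWeight_nonneg hα (sq_nonneg r) ht.le

lemma profile_le_one (hα : ∀ c, 0 ≤ α c) (hsum : ∑ c, α c = 1) {t : ℝ} (ht : 0 < t) (r : ℝ) :
    profile α g t r ≤ 1 := by
  rcases le_or_gt r 0 with hr | hr
  · rw [profile_of_nonpos hr]
    exact zero_le_one
  · rw [profile_of_pos hr]
    exact (isRealSolution_realSolution hα (sq_nonneg r) ht).meanWeight_le_one hα hsum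
      (sq_nonneg r) ht.le

lemma IsSolution.bTrace_eq_profile {z : ℂ} {t : ℝ} {a a' : Fin D → ℂ}
    (h : IsSolution α g z (t * Complex.I) a a') (hα : ∀ c, 0 ≤ α c) (ht : 0 < t) :
    bTrace α g z (t * Complex.I) a a' = -z / (‖z‖ : ℂ) ^ 2 * profile α g t ‖z‖ := by
  rcases eq_or_ne z 0 with rfl | hz
  · simp only [bTrace, neg_zero, zero_div, mul_zero, Finset.sum_const_zero, zero_mul]
  have norm_ne_zero : (‖z‖ : ℂ) ≠ 0 := Complex.ofReal_ne_zero.2 (norm_ne_zero_iff.2 hz)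
  obtain ⟨rfl, rfl⟩ := h.eq_realSolution hα ht
  rw [bTrace, profile_of_pos (norm_pos_iff.2 hz), meanWeight, Complex.ofReal_sum, Finset.mul_sum]
  refine Finset.sum_congr rfl fun c _ => ?_
  rw [denom_ofReal_mul_I, weight]
  push_cast
  field_simp

theorem isLimitingMeasure_iff (hα : ∀ c, 0 ≤ α c) {μ : Measure ℂ} :
    IsLimitingMeasure α g μ ↔ IsProbabilityMeasure μ ∧
      ∀ φ : ℂ → ℂ, ContDiff ℝ ∞ φ → HasCompactSupport φ →
        Tendsto (fun t : ℝ => (1 / (Real.pi : ℂ)) *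
          ∫ z : ℂ, -z / (‖z‖ : ℂ) ^ 2 * profile α g t ‖z‖ * wirtinger φ z)
          (𝓝[>] 0) (𝓝 (∫ z, φ z ∂μ)) := by
  have integral_eq (a a' : ℂ → ℝ → Fin D → ℂ)
      (h : ∀ z : ℂ, ∀ t : ℝ, 0 < t → IsSolution α g z (t * Complex.I) (a z t) (a' z t))
      (φ : ℂ → ℂ) : (fun t : ℝ => (1 / (Real.pi : ℂ)) *
          ∫ z : ℂ, bTrace α g z (t * Complex.I) (a z t) (a' z t) * wirtinger φ z)
        =ᶠ[𝓝[>] 0] fun t : ℝ => (1 / (Real.pi : ℂ)) *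
          ∫ z : ℂ, -z / (‖z‖ : ℂ) ^ 2 * profile α g t ‖z‖ * wirtinger φ z := by
    filter_upwards [eventually_mem_nhdsWithin] with t ht
    simp only [(h _ t ht).bTrace_eq_profile hα ht]
  refine and_congr_right fun _ => ⟨?_, fun tendsto_profile => ?_⟩
  · rintro ⟨a, a', h, tendsto_bTrace⟩ φ hφ hc
    exact (tendsto_bTrace φ hφ hc).congr' (integral_eq a a' h φ)
  · have exists_solution (z : ℂ) (t : ℝ) :
        ∃ p : (Fin D → ℂ) × (Fin D → ℂ), 0 < t → IsSolution α g z (t * Complex.I) p.1 p.2 := by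
      by_cases ht : 0 < t
      · exact (existsUnique_isSolution hα z ht).exists.imp fun p hp _ => hp
      · exact ⟨0, fun ht' => absurd ht' ht⟩
    choose p hp using exists_solution
    exact ⟨fun z t => (p z t).1, fun z t => (p z t).2, hp, fun φ hφ hc =>
      (tendsto_profile φ hφ hc).congr' (integral_eq _ _ hp φ).symm⟩

lemma IsLimitingMeasure.unique {μ ν : Measure ℂ} (hμ : IsLimitingMeasure α g μ)
    (hν : IsLimitingMeasure α g ν) (hα : ∀ c, 0 ≤ α c) : μ = ν := by
  obtain ⟨_, tendsto_μ⟩ := (isLimitingMeasure_iff hα).1 hμ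
  obtain ⟨_, tendsto_ν⟩ := (isLimitingMeasure_iff hα).1 hν
  refine ext_of_forall_integral_contDiff_eq fun φ hφ hc => Complex.ofReal_injective ?_
  rw [← integral_complex_ofReal, ← integral_complex_ofReal]
  have hφ' : ContDiff ℝ ∞ fun z => (φ z : ℂ) := Complex.ofRealCLM.contDiff.comp hφ
  have hc' : HasCompactSupport fun z => (φ z : ℂ) := hc.comp_left Complex.ofReal_zero
  exact tendsto_nhds_unique (tendsto_μ _ hφ' hc') (tendsto_ν _ hφ' hc')

/-- The limit of the profiles as `t → 0`; it exists by `tendsto_profile`. -/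
noncomputable def limitProfile (α : Fin D → ℝ) (g : Matrix (Fin D) (Fin D) ℝ) (r : ℝ) : ℝ :=
  limUnder (𝓝[>] 0) fun t => profile α g t r

lemma limitProfile_of_nonpos {r : ℝ} (hr : r ≤ 0) : limitProfile α g r = 0 := by
  simp only [limitProfile, profile_of_nonpos hr, tendsto_const_nhds.limUnder_eq]

section LimitProfile

variable [Nonempty (Fin D)] (hα : ∀ c, 0 < α c) (hg : ∀ c d, 0 < g c d)
include hα hg

lemma exists_limitProfile_eq_meanWeight {r : ℝ}
    (hr : r ∈ Set.Ioo 0 √(perronEigenvalue α g)) :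
    ∃ v w, IsRealSolution α g (r ^ 2) 0 v w ∧ limitProfile α g r = meanWeight α g (r ^ 2) 0 v w ∧
      Tendsto (fun t => profile α g t r) (𝓝[>] 0) (𝓝 (limitProfile α g r)) := by
  obtain ⟨v, w, h, tendsto⟩ := exists_tendsto_meanWeight hα hg (pow_pos hr.1 2)
    ((Real.lt_sqrt hr.1.le).1 hr.2) fun t ht =>
      isRealSolution_realSolution (fun c => (hα c).le) (sq_nonneg r) ht
  simp only [← profile_of_pos hr.1] at tendsto
  have limit_eq : limitProfile α g r = meanWeight α g (r ^ 2) 0 v w := tendsto.limUnder_eq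
  exact ⟨v, w, h, limit_eq, limit_eq ▸ tendsto⟩

lemma tendsto_profile_one (hsum : ∑ c, α c = 1) {r : ℝ} (hr : √(perronEigenvalue α g) ≤ r) :
    Tendsto (fun t => profile α g t r) (𝓝[>] 0) (𝓝 1) := by
  have r_pos := (Real.sqrt_pos.2 (exists_pos_perronEigenvector hα hg).1).trans_le hr
  simp only [profile_of_pos r_pos]
  exact tendsto_meanWeight_one hα hsum hg ((Real.sqrt_le_left r_pos.le).1 hr) fun t ht =>
    isRealSolution_realSolution (fun c => (hα c).le) (sq_nonneg r) ht

lemma tendsto_profile (hsum : ∑ c, α c = 1) (r : ℝ) :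
    Tendsto (fun t => profile α g t r) (𝓝[>] 0) (𝓝 (limitProfile α g r)) := by
  refine tendsto_nhds_limUnder ?_
  rcases le_or_gt r 0 with hr₀ | hr₀
  · exact ⟨0, by simp only [profile_of_nonpos hr₀, tendsto_const_nhds]⟩
  rcases lt_or_ge r √(perronEigenvalue α g) with hr | hr
  · obtain ⟨-, -, -, -, tendsto⟩ := exists_limitProfile_eq_meanWeight hα hg ⟨hr₀, hr⟩
    exact ⟨_, tendsto⟩
  · exact ⟨1, tendsto_profile_one hα hg hsum hr⟩

lemma strictMonoOn_limitProfile :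
    StrictMonoOn (limitProfile α g) (Set.Ioo 0 √(perronEigenvalue α g)) := by
  intro r hr s hs hrs
  obtain ⟨_, _, h_r, limit_r, -⟩ := exists_limitProfile_eq_meanWeight hα hg hr
  obtain ⟨_, _, h_s, limit_s, -⟩ := exists_limitProfile_eq_meanWeight hα hg hs
  rw [limit_r, limit_s]
  exact h_r.meanWeight_lt_meanWeight h_s hα (pow_pos hr.1 2)
    (pow_lt_pow_left₀ hrs hr.1.le two_ne_zero) le_rfl

omit hg in
lemma monotone_profile {t : ℝ} (ht : 0 < t) : Monotone (profile α g t) := by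
  have hα' := fun c => (hα c).le
  refine monotone_iff_forall_lt.2 fun r s hrs => ?_
  rcases le_or_gt r 0 with hr | hr
  · rw [profile_of_nonpos hr]
    exact profile_nonneg hα' ht s
  · rw [profile_of_pos hr, profile_of_pos (hr.trans hrs)]
    exact ((isRealSolution_realSolution hα' (sq_nonneg r) ht).meanWeight_lt_meanWeight
      (isRealSolution_realSolution hα' (sq_nonneg s) ht) hα (pow_pos hr 2)
      (pow_lt_pow_left₀ hrs hr.le two_ne_zero) ht.le).le

lemma monotone_limitProfile (hsum : ∑ c, α c = 1) : Monotone (limitProfile α g) :=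
  fun r s hrs => le_of_tendsto_of_tendsto (tendsto_profile hα hg hsum r)
    (tendsto_profile hα hg hsum s)
    (eventually_mem_nhdsWithin.mono fun _ ht => monotone_profile hα ht hrs)

theorem exists_stieltjesFunction_tendsto_profile (hsum : ∑ c, α c = 1) :
    ∃ F : StieltjesFunction ℝ, (∀ r < 0, F r = 0) ∧ (∀ r, √(perronEigenvalue α g) ≤ r → F r = 1) ∧
      StrictMonoOn F (Set.Ioo 0 √(perronEigenvalue α g)) ∧
      ∀ᵐ r, Tendsto (fun t => profile α g t r) (𝓝[>] 0) (𝓝 (F r)) := by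
  have monotone := monotone_limitProfile hα hg hsum
  have eq_one {r : ℝ} (hr : √(perronEigenvalue α g) ≤ r) : limitProfile α g r = 1 :=
    (tendsto_profile_one hα hg hsum hr).limUnder_eq
  have ae_continuousAt : ∀ᵐ r : ℝ, ContinuousAt (limitProfile α g) r :=
    ae_iff.2 (monotone.countable_not_continuousAt.measure_zero volume)
  refine ⟨monotone.stieltjesFunction, fun r hr => ?_, fun r hr => ?_, fun r hr s hs hrs => ?_, ?_⟩
  · obtain ⟨s, hrs, hs⟩ := exists_between hr
    exact le_antisymm ((monotone.rightLim_le hrs).trans_eq (limitProfile_of_nonpos hs.le))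
      ((limitProfile_of_nonpos hr.le).symm.trans_le (monotone.le_rightLim le_rfl))
  · exact le_antisymm
      ((monotone.rightLim_le (lt_add_one r)).trans_eq (eq_one (hr.trans (lt_add_one r).le)))
      ((eq_one hr).symm.trans_le (monotone.le_rightLim le_rfl))
  · obtain ⟨m, hrm, hms⟩ := exists_between hrs
    calc monotone.stieltjesFunction r ≤ limitProfile α g m := monotone.rightLim_le hrm
      _ < limitProfile α g s :=
          strictMonoOn_limitProfile hα hg ⟨hr.1.trans hrm, hms.trans hs.2⟩ hs hms
      _ ≤ monotone.stieltjesFunction s := monotone.le_rightLim le_rfl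
  · filter_upwards [ae_continuousAt] with r hr
    rw [monotone.stieltjesFunction_eq, hr.continuousWithinAt.rightLim_eq]
    exact tendsto_profile hα hg hsum r

theorem exists_isLimitingMeasure (hsum : ∑ c, α c = 1) :
    ∃ μ : Measure ℂ, IsLimitingMeasure α g μ ∧
      μ.support = Metric.closedBall (0 : ℂ) √(perronEigenvalue α g) ∧
      ∀ w : ℂ, ‖w‖ = 1 → μ.map (fun z => w * z) = μ := by
  have hα' := fun c => (hα c).le
  have radius_pos := Real.sqrt_pos.2 (exists_pos_perronEigenvector hα hg).1
  obtain ⟨F, F_neg, F_one, F_strictMono, tendsto_F⟩ :=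
    exists_stieltjesFunction_tendsto_profile hα hg hsum
  have tendsto_bot : Tendsto F atBot (𝓝 0) :=
    tendsto_const_nhds.congr' ((eventually_lt_atBot 0).mono fun r hr => (F_neg r hr).symm)
  have tendsto_top : Tendsto F atTop (𝓝 1) :=
    tendsto_const_nhds.congr' ((eventually_ge_atTop _).mono fun r hr => (F_one r hr).symm)
  have := F.isProbabilityMeasure tendsto_bot tendsto_top
  have support_F : F.measure.support = Set.Icc 0 √(perronEigenvalue α g) :=
    support_stieltjes_measure radius_pos F_neg F_one F_strictMono
  have F_Iio_zero : F.measure (Set.Iio 0) = 0 := measure_mono_null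
    (t := F.measure.supportᶜ) (fun r hr mem => (support_F.subset mem).1.not_gt hr)
    Measure.measure_compl_support
  refine ⟨radialMeasure F.measure, (isLimitingMeasure_iff hα').2 ⟨inferInstance, fun φ hφ hc => ?_⟩,
    ?_, fun w hw => map_mul_radialMeasure _ hw⟩
  · exact tendsto_integral_radial F_neg (fun t ht => (monotone_profile hα ht).measurable)
      (fun t ht r => (abs_of_nonneg (profile_nonneg hα' ht r)).trans_le
        (profile_le_one hα' hsum ht r)) (ae_restrict_of_ae tendsto_F)
      (hφ.of_le (mod_cast le_top)) hc
  · ext z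
    simp only [support_radialMeasure F_Iio_zero, support_F, Set.mem_ofPred_eq, Set.mem_Icc,
      norm_nonneg, true_and, mem_closedBall_zero_iff]

end LimitProfile

/-! ### The solution inside and outside the disk -/

section SolutionLimit

variable [Nonempty (Fin D)] {z : ℂ} {a a' : ℝ → Fin D → ℂ}

theorem exists_eventually_le_norm_sum (hα : ∀ c, 0 < α c) (hg : ∀ c d, 0 < g c d)
    (h : ∀ t : ℝ, 0 < t → IsSolution α g z (t * Complex.I) (a t) (a' t))
    (hz : ‖z‖ ^ 2 < perronEigenvalue α g) :
    ∃ C : ℝ, 0 < C ∧ ∀ᶠ t in 𝓝[>] (0 : ℝ), C ≤ ‖∑ c, (α c : ℂ) * a t c‖ := by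
  obtain ⟨C, hC, eventually_le⟩ := exists_eventually_le_sum hα hg (sq_nonneg ‖z‖) hz
  refine ⟨C, hC, ?_⟩
  filter_upwards [eventually_le, eventually_mem_nhdsWithin] with t le_sum ht
  refine (le_sum _ _ (isRealSolution_realSolution (fun c => (hα c).le)
    (sq_nonneg ‖z‖) ht)).trans ((le_abs_self _).trans_eq ?_)
  rw [((h t ht).eq_realSolution (fun c => (hα c).le) ht).1, ← Real.norm_eq_abs,
    ← Complex.norm_real]
  simp only [← mul_assoc, ← Finset.sum_mul, norm_mul, Complex.norm_I, mul_one,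
    ← Complex.ofReal_mul, ← Complex.ofReal_sum]

theorem tendsto_solution_zero (hα : ∀ c, 0 < α c) (hg : ∀ c d, 0 < g c d)
    (h : ∀ t : ℝ, 0 < t → IsSolution α g z (t * Complex.I) (a t) (a' t))
    (hz : perronEigenvalue α g ≤ ‖z‖ ^ 2) :
    Tendsto a (𝓝[>] 0) (𝓝 0) ∧ Tendsto a' (𝓝[>] 0) (𝓝 0) := by
  have hα' := fun c => (hα c).le
  have tendsto_mul_I {V : ℝ → Fin D → ℝ} (hV : Tendsto V (𝓝[>] 0) (𝓝 0)) :
      Tendsto (fun t d => (V t d : ℂ) * Complex.I) (𝓝[>] 0) (𝓝 0) := by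
    have continuous_mul_I : Continuous fun (v : Fin D → ℝ) d => (v d : ℂ) * Complex.I := by fun_prop
    refine (continuous_mul_I.tendsto' 0 0 ?_).comp hV
    ext d
    simp only [Pi.zero_apply, Complex.ofReal_zero, zero_mul]
  obtain ⟨tendsto_fst, tendsto_snd⟩ := tendsto_zero_of_perronEigenvalue_le hα hg hz fun t ht =>
    isRealSolution_realSolution hα' (sq_nonneg ‖z‖) ht
  refine ⟨(tendsto_mul_I tendsto_fst).congr' ?_, (tendsto_mul_I tendsto_snd).congr' ?_⟩
  all_goals filter_upwards [eventually_mem_nhdsWithin] with t ht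
  · exact ((h t ht).eq_realSolution hα' ht).1.symm
  · exact ((h t ht).eq_realSolution hα' ht).2.symm

end SolutionLimit

end BlockMatrix

theorem mainTheorem2 {D : ℕ} (α : Fin D → ℝ) (g : Matrix (Fin D) (Fin D) ℝ)
    (hα : ∀ c, 0 < α c) (hsum : ∑ c, α c = 1) (hg : ∀ c d, 0 < g c d) :
    -- the fixed-point equations have a unique positive solution
    (∀ z : ℂ, ∀ t : ℝ, 0 < t →
      ∃! p : (Fin D → ℂ) × (Fin D → ℂ),
        BlockMatrix.IsSolution α g z (t * Complex.I) p.1 p.2) ∧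
    -- the limiting measure exists and is unique
    (∃! μ : MeasureTheory.Measure ℂ, BlockMatrix.IsLimitingMeasure α g μ) ∧
    -- its support is the closed disk of radius `√λ`, and it is radially symmetric
    (∀ μ : MeasureTheory.Measure ℂ, BlockMatrix.IsLimitingMeasure α g μ →
      μ.support = Metric.closedBall (0 : ℂ) (Real.sqrt (BlockMatrix.perronEigenvalue α g)) ∧
      ∀ w : ℂ, ‖w‖ = 1 → μ.map (fun z => w * z) = μ) ∧
    -- behaviour of the solution as `t → 0+` inside and outside the disk
    (∀ (z : ℂ) (a a' : ℝ → Fin D → ℂ),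
      (∀ t : ℝ, 0 < t → BlockMatrix.IsSolution α g z (t * Complex.I) (a t) (a' t)) →
      (‖z‖ ^ 2 < BlockMatrix.perronEigenvalue α g →
        ∃ C : ℝ, 0 < C ∧ ∀ᶠ t in nhdsWithin (0 : ℝ) (Set.Ioi 0),
          C ≤ ‖∑ c, (α c : ℂ) * a t c‖) ∧
      (BlockMatrix.perronEigenvalue α g < ‖z‖ ^ 2 →
        Filter.Tendsto a (nhdsWithin 0 (Set.Ioi 0)) (nhds 0) ∧
        Filter.Tendsto a' (nhdsWithin 0 (Set.Ioi 0)) (nhds 0))) := by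
  have : Nonempty (Fin D) := not_isEmpty_iff.1 fun _ => by simp at hsum
  obtain ⟨μ, hμ, support_eq, map_mul_eq⟩ := BlockMatrix.exists_isLimitingMeasure hα hg hsum
  have unique (ν : MeasureTheory.Measure ℂ) (hν : BlockMatrix.IsLimitingMeasure α g ν) : ν = μ :=
    hν.unique hμ fun c => (hα c).le
  refine ⟨fun z t ht => BlockMatrix.existsUnique_isSolution (fun c => (hα c).le) z ht,
    ⟨μ, hμ, unique⟩, fun ν hν => ?_, fun z a a' h => ⟨fun hz => ?_, fun hz => ?_⟩⟩
  · rw [unique ν hν]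
    exact ⟨support_eq, map_mul_eq⟩
  · exact BlockMatrix.exists_eventually_le_norm_sum hα hg h hz
  · exact BlockMatrix.tendsto_solution_zero hα hg h hz.le
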